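/- Let $d\ge 0$ and $k\ge 1$ be integers and let $f:\mathbb R^d\to[0,\infty)$ be a measurable, essentially bounded function with $\int_{\mathbb R^d} f(x)\,dx=1$. Let $r=r(n)\ge 0$, and let $\rho=\rho(n)=(p_1,p_2,\dots)$ with $p_i=p_i(n)\in[0,1]$, where $p_1(n),\dots,p_k(n)>0$ for all sufficiently large $n$. Let $X_1,\dots,X_n$ be i.i.d. random points of $\mathbb R^d$ with density $f$. The soft random Čech complex $C(n,r,\rho)$ is the random simplicial complex with vertex set $\{X_1,\dots,X_n\}$ built as follows. Independently of the points, every set $\tau$ of $i+1\ge 2$ vertices is kept with probability $p_i$, independently of all others. A nonempty set $\sigma$ of vertices is a simplex of $C(n,r,\rho)$ if and only if $\bigcap_{X_j\in\sigma}B(X_j,r/2)\neq\emptyset$, where $B(x,s)$ is the closed ball, and every $\tau\subseteq\sigma$ with at least two vertices is kept. (Thus a simplex of dimension $i\ge1$ of the Čech complex all of whose proper faces are present is included with probability $p_i$.) Let $\beta_k=\dim_F H_k(\,\cdot\,;F)$ be the $k$-th Betti number over a fixed field $F$. An event holds asymptotically almost surely (a.a.s.) if its probability tends to $1$ as $n\to\infty$.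 **Theorem.** Assume that $$\lim_{n\to\infty}\frac{n r^d}{\prod_{i=1}^{k}p_i^{\binom{k+1}{i}}}=0 .$$ 1. If $\displaystyle\prod_{i=1}^{k}p_i^{\binom{k+2}{i+1}}\,n^{k+2}r^{d(k+1)}\to 0$, then $\beta_k(C(n,r,\rho))=0$ a.a.s. 2. If $\displaystyle\prod_{i=1}^{k}p_i^{\binom{k+2}{i+1}}\,n^{k+2}r^{d(k+1)}\to\infty$, and if $k<d$ or $\limsup_{n\to\infty}p_{k+1}(n)<1$, then $\beta_k(C(n,r,\rho))\neq 0$ a.a.s. -/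

import Mathlib

open Filter Topology MeasureTheory
open scoped NNReal

noncomputable section

namespace SoftCech

/-! ### Simplicial homology of an abstract simplicial complex with ordered vertices -/

section Homology

variable (F : Type*) [Field F] {V : Type*} [LinearOrder V] [Fintype V]

/-- The simplicial boundary operator. A chain is recorded by its coefficients: `c s` is the
coefficient of the simplex `s`, which is oriented by the order of its vertices. The operator sends
a simplex `s` with at least two vertices to `∑_{v ∈ s} (-1)^{#{w ∈ s : w < v}} (s \ {v})`, and a
vertex to `0`; so the coefficient of `t` in `∂c` collects the simplices `t ∪ {v}` with `v ∉ t`. -/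
def boundary : (Finset V → F) →ₗ[F] (Finset V → F) where
  toFun c t := if t.Nonempty then
    ∑ v ∈ tᶜ, (-1 : F) ^ (t.filter (· < v)).card * c (insert v t) else 0
  map_add' c c' := by
    ext t
    by_cases h : t.Nonempty <;> simp [h, mul_add, Finset.sum_add_distrib]
  map_smul' a c := by
    ext t
    by_cases h : t.Nonempty <;> simp [h, Finset.mul_sum, mul_left_comm]

variable (K : AbstractSimplicialComplex V) (k : ℕ)

/-- The `k`-chains of `K` with coefficients in `F`: combinations of faces with `k + 1` vertices. -/
def chains : Submodule F (Finset V → F) where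
  carrier := {c | ∀ s, c s ≠ 0 → s ∈ K ∧ s.card = k + 1}
  zero_mem' s h := (h rfl).elim
  add_mem' {a b} ha hb s h := by
    by_cases h0 : a s = 0
    · exact hb s fun h1 => h (by simp [h0, h1])
    · exact ha s h0
  smul_mem' a c hc s h := hc s fun h0 => h (by simp [h0])

/-- The `k`-cycles of `K`. -/
def cycles : Submodule F (Finset V → F) :=
  chains F K k ⊓ LinearMap.ker (boundary F)

/-- The `k`-boundaries of `K`. -/
def boundaries : Submodule F (Finset V → F) :=
  (chains F K (k + 1)).map (boundary F)

lemma boundary_boundary (c : Finset V → F) : boundary F (boundary F c) = 0 := by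
  ext t
  by_cases ht : t.Nonempty
  swap
  · simp [boundary, ht]
  have e : boundary F (boundary F c) t = ∑ v ∈ tᶜ, ∑ w ∈ (insert v t)ᶜ,
      (-1 : F) ^ ((t.filter (· < v)).card + ((insert v t).filter (· < w)).card) *
        c (insert w (insert v t)) := by
    simp [boundary, ht, Finset.mul_sum, pow_add, mul_assoc]
  rw [e, Finset.sum_sigma', Pi.zero_apply]
  refine Finset.sum_involution (fun x _ => ⟨x.2, x.1⟩) ?_ ?_ ?_ ?_
  · rintro ⟨v, w⟩ hx
    simp only [Finset.mem_sigma, Finset.mem_compl, Finset.mem_insert, not_or] at hx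
    obtain ⟨hv, hwv, hw⟩ := hx
    have key : ∀ v w : V, v ∉ t → w ∉ t → v < w →
        (-1 : F) ^ ((t.filter (· < v)).card + ((insert v t).filter (· < w)).card) *
          c (insert w (insert v t)) +
        (-1 : F) ^ ((t.filter (· < w)).card + ((insert w t).filter (· < v)).card) *
          c (insert v (insert w t)) = 0 := by
      intro v w hv hw hlt
      have h1 : (insert w t).filter (· < v) = t.filter (· < v) := by
        rw [Finset.filter_insert, if_neg hlt.not_gt]
      have h2 : ((insert v t).filter (· < w)).card = (t.filter (· < w)).card + 1 := by
        rw [Finset.filter_insert, if_pos hlt, Finset.card_insert_of_notMem (by simp [hv])]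
      rw [h1, h2, Finset.insert_comm w v t]
      ring
    rcases lt_or_gt_of_ne hwv with hlt | hlt
    · rw [add_comm]; exact key w v hw hv hlt
    · exact key v w hv hw hlt
  · rintro ⟨v, w⟩ hx _ heq
    simp only [Finset.mem_sigma, Finset.mem_compl, Finset.mem_insert, not_or] at hx
    simp only [Sigma.mk.injEq] at heq
    exact hx.2.1 heq.1
  · rintro ⟨v, w⟩ hx
    simp only [Finset.mem_sigma, Finset.mem_compl, Finset.mem_insert, not_or] at hx ⊢
    exact ⟨hx.2.2, fun h => hx.2.1 h.symm, hx.1⟩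
  · rintro ⟨v, w⟩ _
    rfl

/-- Every boundary is a cycle. -/
lemma boundaries_le_cycles : boundaries F K k ≤ cycles F K k := by
  rintro _ ⟨c, hc, rfl⟩
  refine ⟨fun t ht => ?_, boundary_boundary F c⟩
  by_cases hne : t.Nonempty
  · have h1 : boundary F c t = ∑ v ∈ tᶜ, (-1 : F) ^ (t.filter (· < v)).card * c (insert v t) := by
      simp [boundary, hne]
    rw [h1] at ht
    obtain ⟨v, hv, hvc⟩ := Finset.exists_ne_zero_of_sum_ne_zero ht
    obtain ⟨hK, hcard⟩ := hc _ (right_ne_zero_of_mul hvc)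
    rw [Finset.card_insert_of_notMem (Finset.mem_compl.1 hv)] at hcard
    exact ⟨(K.isRelLowerSet_faces hK).2 (Finset.subset_insert v t) hne, by omega⟩
  · exact (ht (by simp [boundary, hne])).elim

/-- The `k`-th simplicial homology of `K` with coefficients in `F`: cycles modulo boundaries. -/
abbrev Homology : Type _ := cycles F K k ⧸ (boundaries F K k).submoduleOf (cycles F K k)

/-- The `k`-th Betti number of `K` over `F`. -/
def betti : ℕ := Module.finrank F (Homology F K k)

end Homology

/-! ### The soft random Čech complex -/

/-- The soft Čech complex on the points `x 0, …, x (n - 1)` of `ℝ^d` at scale `r`, given the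
outcomes of the coins: `coin τ` tells whether the simplex `τ` is kept. Its faces are
the sets `s` of vertices whose balls of radius `r / 2` have a common point and such that all the
faces of `s` of dimension at least one, including `s` itself, are kept. Thus, once its
proper faces are present, a simplex `s` of the Čech complex is included iff `coin s` holds. -/
def softCechComplex {d n : ℕ} (r : ℝ≥0) (x : Fin n → EuclideanSpace ℝ (Fin d))
    (coin : Finset (Fin n) → Prop) : AbstractSimplicialComplex (Fin n) where
  faces := {s | s.Nonempty ∧ (⋂ i ∈ s, Metric.closedBall (x i) ((r : ℝ) / 2)).Nonempty ∧
    ∀ τ ⊆ s, 2 ≤ τ.card → coin τ}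
  isRelLowerSet_faces := by
    rintro s ⟨h1, h2, h3⟩
    refine ⟨h1, fun τ hτ hne => ⟨hne, ?_, fun υ hυ => h3 υ (hυ.trans hτ)⟩⟩
    exact h2.mono (Set.biInter_subset_biInter_left hτ)
  singleton_mem v := by
    refine ⟨Finset.singleton_nonempty v, ⟨x v, ?_⟩, fun τ hτ hc => ?_⟩
    · simp only [Finset.mem_singleton, Set.iInter_iInter_eq_left]
      exact Metric.mem_closedBall_self (by positivity)
    · have := Finset.card_le_card hτ
      rw [Finset.card_singleton] at this
      omega

/-- The joint law of the data of the soft random Čech complex on `n` vertices: `n` independent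
points of `ℝ^d` with density `f`, and, independently of them, independent coins indexed by the
sets of vertices, where the coin of an `i`-dimensional simplex (one with `i + 1` vertices)
succeeds with probability `p i`. -/
def softLaw {d : ℕ} (f : EuclideanSpace ℝ (Fin d) → ℝ) (p : ℕ → unitInterval) (n : ℕ) :
    Measure ((Fin n → EuclideanSpace ℝ (Fin d)) × (Finset (Fin n) → Prop)) :=
  (Measure.pi fun _ : Fin n => volume.withDensity fun x => ENNReal.ofReal (f x)).prod
    (Measure.pi fun s : Finset (Fin n) =>
      ProbabilityTheory.bernoulliMeasure True False (p (s.card - 1)))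

end SoftCech

end

/-! Put Q = n (n r^d)^(k+1) ∏ p_i^C(k+2,i+1). Up to constants, Q bounds the expected number of sets
of k + 2 mutually close points all of whose faces of dimensions 1, …, k are kept.

Vanishing: let σ lie in the support of a nonzero k-cycle. The coefficient of the boundary at each
facet of σ must cancel, so each facet lies in another k-face. If a single new vertex serves all
facets, a set bounded by Q appears. Otherwise k + 3 points lie within 3r of each other and contain a
k-face (`cluster_of_betti_ne_zero`). By Pascal's rule (`coinWeight_mul_prod`) the expected number of
the latter is at most a constant times Q times the ratio that is assumed to vanish, and a union
bound finishes.

Nonvanishing: the boundary of a missing (k+1)-simplex is a nontrivial cycle if no outside vertex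
spans a face with one of its facets (`betti_ne_zero_of_empty_simplex`). Missing simplices arise
geometrically from points close to a scaled regular simplex when k < d, and otherwise from a failing
top coin. Lebesgue differentiation and Fatou's lemma give an expected number of at least cQ
(`exists_shapeMass_ge`). Only pairs sharing a vertex contribute to the variance, at most O(Q) in
total, so by Chebyshev at least half the expected number occurs. Pairs of a close set and a further
nearby vertex have expectation O(n r^d Q) = o(Q), so by Markov they cannot spoil all missing
simplices (`betti_eq_zero_measure_le`). -/

namespace SoftCech

/-! ### Homological criteria for a Betti number to be nonzero -/

section Deterministic

variable {F : Type*} [Field F] {V : Type*} [LinearOrder V] [Fintype V]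
  {K : AbstractSimplicialComplex V} {k : ℕ}

lemma betti_ne_zero_iff : betti F K k ≠ 0 ↔ ∃ z ∈ cycles F K k, z ∉ boundaries F K k := by
  rw [betti, Ne, Module.finrank_zero_iff, Submodule.Quotient.subsingleton_iff,
    Submodule.submoduleOf_eq_top, SetLike.le_def]
  push Not
  rfl

lemma boundary_apply {t : Finset V} (ht : t.Nonempty) (c : Finset V → F) :
    boundary F c t = ∑ v ∈ tᶜ, (-1 : F) ^ (t.filter (· < v)).card * c (insert v t) :=
  if_pos ht

/-- A nonzero cycle has a face in its support each of whose facets lies in another face. -/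
lemma exists_face_of_betti_ne_zero (hk : 1 ≤ k) (h : betti F K k ≠ 0) :
    ∃ σ ∈ K, σ.card = k + 1 ∧ ∀ v ∈ σ, ∃ w ∉ σ, insert w (σ.erase v) ∈ K := by
  obtain ⟨z, ⟨hz, hz0⟩, hzb⟩ := betti_ne_zero_iff.1 h
  have hne : z ≠ 0 := fun h0 => hzb (h0 ▸ zero_mem _)
  obtain ⟨σ, hσ⟩ := Function.ne_iff.1 hne
  obtain ⟨hσK, hcard⟩ := hz σ hσ
  refine ⟨σ, hσK, hcard, fun v hv => ?_⟩
  by_contra! hcon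
  have hvm : v ∈ (σ.erase v)ᶜ := by simp
  -- This needs `1 ≤ k`: on the empty set the boundary is zero by convention and gives no
  -- information.
  have hnon : (σ.erase v).Nonempty := by
    rw [← Finset.card_pos, Finset.card_erase_of_mem hv]; omega
  have h0 : boundary F z (σ.erase v) = 0 := congrFun (LinearMap.mem_ker.1 hz0) _
  rw [boundary_apply hnon, Finset.sum_eq_single_of_mem v hvm, Finset.insert_erase hv] at h0
  · exact hσ ((mul_eq_zero.1 h0).resolve_left (pow_ne_zero _ (by simp)))
  · intro w hw hwv
    have hwσ : w ∉ σ := fun hm => Finset.mem_compl.1 hw (Finset.mem_erase.2 ⟨hwv, hm⟩)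
    by_contra hne
    exact hcon w hwσ (hz _ (right_ne_zero_of_mul hne)).1

/-- An empty simplex none of whose facets lies in a larger face carries homology. -/
lemma betti_ne_zero_of_empty_simplex {σ : Finset V} (hcard : σ.card = k + 2)
    (hfacet : ∀ v ∈ σ, σ.erase v ∈ K) (hσ : σ ∉ K)
    (hiso : ∀ v ∈ σ, ∀ w ∉ σ, insert w (σ.erase v) ∉ K) : betti F K k ≠ 0 := by
  -- At a facet of `σ` only `σ` itself contributes. This is applied both to the chain `σ` and to a
  -- supposed filling `c` in `K`.
  have hval : ∀ c : Finset V → F, (∀ v ∈ σ, ∀ w ∉ σ, c (insert w (σ.erase v)) = 0) → ∀ v ∈ σ,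
      boundary F c (σ.erase v) = (-1 : F) ^ ((σ.erase v).filter (· < v)).card * c σ := by
    intro c hc v hv
    have hnon : (σ.erase v).Nonempty := by
      rw [← Finset.card_pos, Finset.card_erase_of_mem hv]; omega
    rw [boundary_apply hnon, Finset.sum_eq_single_of_mem v (by simp), Finset.insert_erase hv]
    intro w hw hwv
    rw [hc v hv w fun hm => Finset.mem_compl.1 hw (Finset.mem_erase.2 ⟨hwv, hm⟩), mul_zero]
  obtain ⟨v, hv⟩ : σ.Nonempty := by rw [← Finset.card_pos]; omega
  -- The chain `σ` does not live in `K`, but its boundary does. A filling in `K` has coefficient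
  -- zero at `σ`, so its boundary vanishes on the facets, where that of `σ` is `±1`.
  refine betti_ne_zero_iff.2 ⟨boundary F (Pi.single σ 1), ⟨fun t ht => ?_, boundary_boundary F _⟩, ?_⟩
  · have hnon : t.Nonempty := by
      by_contra hn
      exact ht (if_neg hn)
    rw [boundary_apply hnon] at ht
    obtain ⟨u, hu, huc⟩ := Finset.exists_ne_zero_of_sum_ne_zero ht
    have hut : insert u t = σ := by
      by_contra hne
      exact right_ne_zero_of_mul huc (Pi.single_eq_of_ne hne _)
    have hu' := Finset.mem_compl.1 hu
    rw [← Finset.erase_insert hu', hut, Finset.card_erase_of_mem (hut ▸ Finset.mem_insert_self u t)]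
    exact ⟨hfacet u (hut ▸ Finset.mem_insert_self u t), by omega⟩
  · rintro ⟨c, hc, hcz⟩
    have h1 := hval c (fun v hv w hw => by
      by_contra hne
      exact hiso v hv w hw (hc _ hne).1) v hv
    have h2 := hval (Pi.single σ 1) (fun v hv w hw => Pi.single_eq_of_ne (fun he =>
      hw (by rw [← he]; exact Finset.mem_insert_self _ _)) _) v hv
    have hcσ : c σ = 0 := by
      by_contra hne
      exact hσ (hc _ hne).1
    rw [hcz, h2, hcσ] at h1
    simp at h1

end Deterministic

/-! ### Clusters of points forced by homology -/

section Complex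

variable {F : Type*} [Field F] {d n k : ℕ} {r : ℝ≥0}

/-- The subsets of `σ` with between `2` and `k + 1` elements. -/
def lowerFaces {n : ℕ} (k : ℕ) (σ : Finset (Fin n)) : Finset (Finset (Fin n)) :=
  σ.powerset.filter fun τ => τ.card ∈ Finset.Icc 2 (k + 1)

/-- The event that the points of `U` are pairwise at distance at most `3 r` and the coins of all the
subsets of `σ` with between `2` and `k + 1` elements succeed. -/
def clusterEvent (d : ℕ) {n : ℕ} (k : ℕ) (r : ℝ≥0) (U σ : Finset (Fin n)) :
    Set ((Fin n → EuclideanSpace ℝ (Fin d)) × (Finset (Fin n) → Prop)) :=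
  {x | ∀ i ∈ U, ∀ j ∈ U, dist (x i) (x j) ≤ 3 * r} ×ˢ
    {c | ∀ τ ∈ lowerFaces k σ, c τ}

lemma mem_softCechComplex {x : Fin n → EuclideanSpace ℝ (Fin d)} {c : Finset (Fin n) → Prop}
    {s : Finset (Fin n)} : s ∈ softCechComplex r x c ↔ s.Nonempty ∧
      (∃ z, ∀ i ∈ s, dist z (x i) ≤ (r : ℝ) / 2) ∧ ∀ τ ⊆ s, 2 ≤ τ.card → c τ := by
  change (_ ∧ _ ∧ _) ↔ _
  simp [Set.Nonempty]

lemma dist_le_of_mem_softCechComplex {x : Fin n → EuclideanSpace ℝ (Fin d)}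
    {c : Finset (Fin n) → Prop} {s : Finset (Fin n)} (hs : s ∈ softCechComplex r x c)
    {i j : Fin n} (hi : i ∈ s) (hj : j ∈ s) : dist (x i) (x j) ≤ r := by
  obtain ⟨-, ⟨z, hz⟩, -⟩ := mem_softCechComplex.1 hs
  linarith [dist_triangle_left (x i) (x j) z, hz i hi, hz j hj]

/-- The dichotomy is whether the vertices that cancel the facets of a face `σ` in the support of a
cycle all coincide. If two differ, keeping only the coins of `σ` is enough, because the extra point
already gains a factor `n r^d`. -/
lemma cluster_of_betti_ne_zero (hk : 1 ≤ k)
    {ω : (Fin n → EuclideanSpace ℝ (Fin d)) × (Finset (Fin n) → Prop)}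
    (h : betti F (softCechComplex r ω.1 ω.2) k ≠ 0) :
    (∃ U : Finset (Fin n), U.card = k + 2 ∧ ω ∈ clusterEvent d k r U U) ∨
      ∃ U : Finset (Fin n), U.card = k + 3 ∧ ∃ σ ⊆ U, σ.card = k + 1 ∧
        ω ∈ clusterEvent d k r U σ := by
  obtain ⟨σ, hσ, hcard, hw⟩ := exists_face_of_betti_ne_zero hk h
  choose! w hwσ hwK using hw
  have hr : (0 : ℝ) ≤ r := r.2
  have hex : ∀ v ∈ σ, ∃ u ∈ σ, u ≠ v := fun v hv => by
    obtain ⟨u, hu, hne⟩ := Finset.exists_mem_ne (s := σ) (by omega) v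
    exact ⟨u, hu, hne⟩
  have hnear : ∀ v ∈ σ, ∃ u ∈ σ, dist (ω.1 (w v)) (ω.1 u) ≤ r := fun v hv => by
    obtain ⟨u, hu, hne⟩ := hex v hv
    exact ⟨u, hu, dist_le_of_mem_softCechComplex (hwK v hv) (by simp) (by simp [hne, hu])⟩
  have hself : ∀ i ∈ σ, ∀ j ∈ σ, dist (ω.1 i) (ω.1 j) ≤ r := fun i hi j hj =>
    dist_le_of_mem_softCechComplex hσ hi hj
  have hσw : ∀ i ∈ σ, ∀ v ∈ σ, dist (ω.1 i) (ω.1 (w v)) ≤ 2 * r := fun i hi v hv => by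
    obtain ⟨u, hu, hd⟩ := hnear v hv
    linarith [dist_triangle_right (ω.1 i) (ω.1 (w v)) (ω.1 u), hself i hi u hu]
  -- The worst case, and the origin of the constant 3: two new vertices are joined through two
  -- vertices of `σ`.
  have hww : ∀ u ∈ σ, ∀ v ∈ σ, dist (ω.1 (w u)) (ω.1 (w v)) ≤ 3 * r := fun u hu v hv => by
    obtain ⟨u', hu', hd⟩ := hnear u hu
    linarith [dist_triangle (ω.1 (w u)) (ω.1 u') (ω.1 (w v)), hσw u' hu' v hv]
  have hwσ' : ∀ v ∈ σ, ∀ i ∈ σ, dist (ω.1 (w v)) (ω.1 i) ≤ 2 * r := fun v hv i hi =>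
    dist_comm (ω.1 i) _ ▸ hσw i hi v hv
  have h3 := fun i hi j hj => (hself i hi j hj).trans (by linarith : (r : ℝ) ≤ 3 * r)
  have h4 := fun i hi j hj => (hσw i hi j hj).trans (by linarith : 2 * (r : ℝ) ≤ 3 * r)
  have h5 := fun i hi j hj => (hwσ' i hi j hj).trans (by linarith : 2 * (r : ℝ) ≤ 3 * r)
  obtain ⟨v₀, hv₀⟩ : σ.Nonempty := by rw [← Finset.card_pos]; omega
  by_cases hall : ∀ v ∈ σ, w v = w v₀
  · left
    refine ⟨insert (w v₀) σ, by rw [Finset.card_insert_of_notMem (hwσ v₀ hv₀), hcard], ?_, ?_⟩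
    · intro i hi j hj
      rcases Finset.mem_insert.1 hi with rfl | hi <;> rcases Finset.mem_insert.1 hj with rfl | hj
      exacts [hww _ hv₀ _ hv₀, h5 _ hv₀ _ hj, h4 _ hi _ hv₀, h3 _ hi _ hj]
    · intro τ hτ
      simp only [lowerFaces, Finset.mem_filter, Finset.mem_powerset, Finset.mem_Icc] at hτ
      by_cases hsub : τ ⊆ σ
      · exact (mem_softCechComplex.1 hσ).2.2 τ hsub hτ.2.1
      -- A set with at most `k + 1` elements that contains the new vertex misses some `v` in `σ`. It
      -- is then a subset of the face that cancels the facet opposite `v`.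
      obtain ⟨v, hv, hvτ⟩ : ∃ v ∈ σ, v ∉ τ := by
        by_contra! hcon
        have h1 : w v₀ ∈ τ := by
          by_contra hn
          refine hsub fun i hi => (Finset.mem_insert.1 (hτ.1 hi)).resolve_left ?_
          rintro rfl
          exact hn hi
        have := Finset.card_le_card (Finset.insert_subset h1 hcon)
        rw [Finset.card_insert_of_notMem (hwσ v₀ hv₀), hcard] at this
        omega
      refine (mem_softCechComplex.1 (hwK v hv)).2.2 τ (fun i hi => ?_) hτ.2.1
      rw [hall v hv]
      rcases Finset.mem_insert.1 (hτ.1 hi) with rfl | hi'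
      · exact Finset.mem_insert_self _ _
      · refine Finset.mem_insert_of_mem (Finset.mem_erase.2 ⟨?_, hi'⟩)
        rintro rfl
        exact hvτ hi
  · right
    push Not at hall
    obtain ⟨v, hv, hne⟩ := hall
    have hn : w v ∉ insert (w v₀) σ := by simp [hne, hwσ v hv]
    refine ⟨insert (w v) (insert (w v₀) σ), ?_, σ, fun i hi => by simp [hi], hcard, ?_, ?_⟩
    · rw [Finset.card_insert_of_notMem hn, Finset.card_insert_of_notMem (hwσ v₀ hv₀), hcard]
    · intro i hi j hj
      rcases Finset.mem_insert.1 hi with rfl | hi <;> rcases Finset.mem_insert.1 hj with rfl | hj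
      · exact hww _ hv _ hv
      · rcases Finset.mem_insert.1 hj with rfl | hj
        exacts [hww _ hv _ hv₀, h5 _ hv _ hj]
      · rcases Finset.mem_insert.1 hi with rfl | hi
        exacts [hww _ hv₀ _ hv, h4 _ hi _ hv]
      · rcases Finset.mem_insert.1 hi with rfl | hi <;> rcases Finset.mem_insert.1 hj with rfl | hj
        exacts [hww _ hv₀ _ hv₀, h5 _ hv₀ _ hj, h4 _ hi _ hv₀, h3 _ hi _ hj]
    · intro τ hτ
      simp only [lowerFaces, Finset.mem_filter, Finset.mem_powerset, Finset.mem_Icc] at hτ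
      exact (mem_softCechComplex.1 hσ).2.2 τ hτ.1 hτ.2.1

end Complex

/-! ### Independence in finite product spaces -/

section Product

open ProbabilityTheory

variable {ι : Type*} [Fintype ι] {Ω : ι → Type*} [∀ i, MeasurableSpace (Ω i)]
  (μ : ∀ i, Measure (Ω i)) [∀ i, IsProbabilityMeasure (μ i)]

lemma pi_cylinder (T : Finset ι) (s : ∀ i, Set (Ω i)) :
    Measure.pi μ {x | ∀ i ∈ T, x i ∈ s i} = ∏ i ∈ T, μ i (s i) := by
  classical
  have h : {x : ∀ i, Ω i | ∀ i ∈ T, x i ∈ s i} =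
      Set.univ.pi fun i => if i ∈ T then s i else Set.univ := by
    ext x
    simp only [Set.mem_ofPred_eq, Set.mem_univ_pi]
    exact forall_congr' fun i => by by_cases hi : i ∈ T <;> simp [hi]
  rw [h, Measure.pi_pi, ← Finset.prod_subset (Finset.subset_univ T)]
  · exact Finset.prod_congr rfl fun i hi => by rw [if_pos hi]
  · intro i _ hi
    rw [if_neg hi, measure_univ]

/-- Events that depend on disjoint sets of coordinates are independent. -/
lemma pi_inter_of_disjoint {A B : Set (∀ i, Ω i)} {S T : Finset ι} (hST : Disjoint S T)
    (hA : MeasurableSet A) (hB : MeasurableSet B)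
    (hAS : ∀ x y, (∀ i ∈ S, x i = y i) → x ∈ A → y ∈ A)
    (hBT : ∀ x y, (∀ i ∈ T, x i = y i) → x ∈ B → y ∈ B) :
    Measure.pi μ (A ∩ B) = Measure.pi μ A * Measure.pi μ B := by
  classical
  have hne : ∀ i, Nonempty (Ω i) := fun i => (μ i).nonempty_of_neZero
  let o : ∀ i, Ω i := fun i => Classical.choice (hne i)
  -- Filling the other coordinates with the default point `o` exhibits an event depending only on
  -- `R` as a preimage under restriction to `R`.
  let ext (R : Finset ι) (y : ∀ i : R, Ω i) : ∀ i, Ω i :=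
    fun i => if h : i ∈ R then y ⟨i, h⟩ else o i
  have hext : ∀ R, Measurable (ext R) := fun R => measurable_pi_lambda _ fun i => by
    by_cases h : i ∈ R
    · simp only [ext, h, dite_true]
      exact measurable_pi_apply _
    · simp only [ext, h, dite_false]
      exact measurable_const
  have hpre : ∀ (R : Finset ι) (C : Set (∀ i, Ω i)),
      (∀ x y, (∀ i ∈ R, x i = y i) → x ∈ C → y ∈ C) →
      C = (fun (x : ∀ i, Ω i) (i : R) => x i) ⁻¹' (ext R ⁻¹' C) := by
    intro R C hC
    ext x
    have : ∀ i ∈ R, x i = ext R (fun i : R => x i) i := fun i hi => by simp [ext, hi]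
    exact ⟨hC _ _ this, hC _ _ fun i hi => (this i hi).symm⟩
  have hind := (iIndepFun_pi (μ := μ) (X := fun _ => id)
    fun i => aemeasurable_id).indepFun_finset S T hST fun i => measurable_pi_apply i
  rw [hpre S A hAS, hpre T B hBT]
  exact hind.measure_inter_preimage_eq_mul _ _ (hext S hA) (hext T hB)

/-- The probability that finitely many independent points lie in prescribed sets that depend on one
further point. -/
lemma pi_pinned {X : Type*} [MeasurableSpace X] (ν : Measure X) [IsProbabilityMeasure ν] {n : ℕ}
    (v : Fin n) (T : Finset (Fin n)) (hv : v ∉ T) (B : Fin n → Set (X × X))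
    (hB : ∀ i, MeasurableSet (B i)) :
    Measure.pi (fun _ : Fin n => ν) {x | ∀ i ∈ T, (x v, x i) ∈ B i} =
      ∫⁻ y, ∏ i ∈ T, ν {z | (y, z) ∈ B i} ∂ν := by
  classical
  obtain _ | n := n
  · exact v.elim0
  have hmp := measurePreserving_piFinSuccAbove (fun _ : Fin (n + 1) => ν) v
  let T' : Finset (Fin n) := Finset.univ.filter fun j => v.succAbove j ∈ T
  have hT : T = T'.map v.succAboveEmb := by
    ext i
    simp only [Finset.mem_map, T', Finset.mem_filter, Finset.mem_univ, true_and]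
    constructor
    · intro hi
      obtain ⟨j, rfl⟩ := Fin.exists_succAbove_eq (x := i) (y := v) (by rintro rfl; exact hv hi)
      exact ⟨j, hi, rfl⟩
    · rintro ⟨j, hj, rfl⟩
      exact hj
  let A : Set (X × (Fin n → X)) := {q | ∀ j ∈ T', (q.1, q.2 j) ∈ B (v.succAbove j)}
  have hA : MeasurableSet A := by
    have : A = ⋂ j ∈ T', (fun q : X × (Fin n → X) => (q.1, q.2 j)) ⁻¹' B (v.succAbove j) := by
      ext q; simp [A]
    rw [this]
    exact MeasurableSet.biInter T'.countable_toSet fun j _ => (hB _).preimage (by fun_prop)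
  have hpre : {x : Fin (n + 1) → X | ∀ i ∈ T, (x v, x i) ∈ B i} =
      MeasurableEquiv.piFinSuccAbove (fun _ => X) v ⁻¹' A := by
    ext x
    rw [hT]
    simp [A, Fin.removeNth]
  rw [hpre, hmp.measure_preimage hA.nullMeasurableSet, Measure.prod_apply hA]
  refine lintegral_congr fun y => ?_
  rw [hT, Finset.prod_map]
  exact pi_cylinder (fun _ : Fin n => ν) T' fun j => {z | (y, z) ∈ B (v.succAbove j)}

end Product

/-! ### The laws of the points and of the coins -/

section Law

open ProbabilityTheory

variable {d : ℕ}

/-- The law of a point with density `f`. -/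
noncomputable def pointLaw (f : EuclideanSpace ℝ (Fin d) → ℝ) : Measure (EuclideanSpace ℝ (Fin d)) :=
  volume.withDensity fun x => ENNReal.ofReal (f x)

/-- The law of the coins. -/
noncomputable def coinLaw (p : ℕ → unitInterval) (n : ℕ) : Measure (Finset (Fin n) → Prop) :=
  Measure.pi fun s : Finset (Fin n) => bernoulliMeasure True False (p (s.card - 1))

instance (p : ℕ → unitInterval) (n : ℕ) : IsProbabilityMeasure (coinLaw p n) := by
  unfold coinLaw; infer_instance

lemma softLaw_eq (f : EuclideanSpace ℝ (Fin d) → ℝ) (p : ℕ → unitInterval) (n : ℕ) :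
    softLaw f p n = (Measure.pi fun _ : Fin n => pointLaw f).prod (coinLaw p n) := rfl

lemma isProbabilityMeasure_pointLaw {f : EuclideanSpace ℝ (Fin d) → ℝ} 
    (hf0 : ∀ x, 0 ≤ f x) (hf1 : ∫ x, f x = 1) : IsProbabilityMeasure (pointLaw f) := by
  -- The integral of a nonintegrable function is 0 by convention, which excludes the value 1.
  have hint : Integrable f := by
    by_contra h
    rw [integral_undef h] at hf1
    exact zero_ne_one hf1
  refine ⟨?_⟩
  rw [pointLaw, withDensity_apply _ MeasurableSet.univ, Measure.restrict_univ,
    ← ofReal_integral_eq_lintegral_ofReal hint (ae_of_all _ hf0), hf1, ENNReal.ofReal_one]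

/-- The essential bound on `f` compares the law with Lebesgue measure. The radius matches the
diameter allowed in `clusterEvent`. -/
lemma pointLaw_closedBall_le {f : EuclideanSpace ℝ (Fin d) → ℝ}
    (hfM : ∃ M : ℝ, ∀ᵐ x, f x ≤ M) : ∃ C : ℝ, 0 ≤ C ∧ ∀ (x : EuclideanSpace ℝ (Fin d)) (r : ℝ≥0),
      pointLaw f (Metric.closedBall x (3 * r)) ≤ ENNReal.ofReal (C * (r : ℝ) ^ d) := by
  obtain ⟨M, hM⟩ := hfM
  let V := (volume (Metric.ball (0 : EuclideanSpace ℝ (Fin d)) 1)).toReal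
  refine ⟨max M 0 * 3 ^ d * V, by positivity, fun x r => ?_⟩
  rw [pointLaw, withDensity_apply _ Metric.isClosed_closedBall.measurableSet]
  calc ∫⁻ y in Metric.closedBall x (3 * r), ENNReal.ofReal (f y)
      ≤ ∫⁻ _ in Metric.closedBall x (3 * r), ENNReal.ofReal (max M 0) := by
        refine lintegral_mono_ae (ae_restrict_of_ae (hM.mono fun y hy => ?_))
        exact ENNReal.ofReal_le_ofReal (hy.trans (le_max_left _ _))
    _ = ENNReal.ofReal (max M 0 * 3 ^ d * V * (r : ℝ) ^ d) := by
        rw [setLIntegral_const, Measure.addHaar_closedBall _ _ (by positivity),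
          finrank_euclideanSpace, Fintype.card_fin,
          ← ENNReal.ofReal_toReal (measure_ball_lt_top (μ := volume)
            (x := (0 : EuclideanSpace ℝ (Fin d))) (r := 1)).ne,
          ← ENNReal.ofReal_mul (by positivity), ← ENNReal.ofReal_mul (by positivity)]
        congr 1
        simp only [V]
        ring

/-- The probability that all the coins of dimension `1, …, k` on `m` vertices succeed. -/
noncomputable def coinWeight (p : ℕ → unitInterval) (k m : ℕ) : ℝ :=
  ∏ i ∈ Finset.Icc 1 k, (p i : ℝ) ^ m.choose (i + 1)

lemma coinWeight_nonneg (p : ℕ → unitInterval) (k m : ℕ) : 0 ≤ coinWeight p k m :=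
  Finset.prod_nonneg fun i _ => pow_nonneg (p i).2.1 _

lemma bernoulli_true (q : unitInterval) :
    bernoulliMeasure True False q {True} = ENNReal.ofReal q := by
  classical
  rw [bernoulliMeasure_apply _ (MeasurableSet.singleton _)]
  simp [ENNReal.ofReal, unitInterval.toNNReal]
  congr 1
  ext
  simp [q.2.1]
  rfl

lemma bernoulli_false (q : unitInterval) :
    bernoulliMeasure True False q {False} = ENNReal.ofReal (1 - q) := by
  classical
  rw [bernoulliMeasure_apply _ (MeasurableSet.singleton _)]
  simp [ENNReal.ofReal, unitInterval.toNNReal]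
  congr 1
  ext
  simp [q.2.2]
  rfl

/-- Group the subsets by dimension: `σ` has `σ.card.choose (i + 1)` faces of dimension `i`. -/
lemma prod_lowerFaces (p : ℕ → unitInterval) {n : ℕ} (k : ℕ) (σ : Finset (Fin n)) :
    ∏ τ ∈ lowerFaces k σ, ENNReal.ofReal (p (τ.card - 1)) =
      ENNReal.ofReal (coinWeight p k σ.card) := by
  rw [coinWeight, ENNReal.ofReal_prod_of_nonneg fun i _ => pow_nonneg (p i).2.1 _]
  rw [← Finset.prod_fiberwise_of_maps_to (s := lowerFaces k σ) (t := Finset.Icc 1 k)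
    (g := fun τ => τ.card - 1)]
  · refine Finset.prod_congr rfl fun i hi => ?_
    have hi := Finset.mem_Icc.1 hi
    have : (lowerFaces k σ).filter (fun τ => τ.card - 1 = i) = σ.powersetCard (i + 1) := by
      ext τ
      simp only [lowerFaces, Finset.mem_filter, Finset.mem_powerset, Finset.mem_Icc,
        Finset.mem_powersetCard]
      constructor
      · rintro ⟨⟨h1, h2⟩, h3⟩
        exact ⟨h1, by omega⟩
      · rintro ⟨h1, h2⟩
        exact ⟨⟨h1, by omega⟩, by omega⟩
    rw [this, ENNReal.ofReal_pow (p i).2.1, ← Finset.card_powersetCard,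
      Finset.prod_congr rfl fun τ hτ => by rw [(Finset.mem_powersetCard.1 hτ).2], Finset.prod_const]
    simp
  · intro τ hτ
    simp only [lowerFaces, Finset.mem_filter, Finset.mem_Icc] at hτ ⊢
    omega

lemma coinLaw_lowerFaces (p : ℕ → unitInterval) {n : ℕ} (k : ℕ) (σ : Finset (Fin n)) :
    coinLaw p n {c | ∀ τ ∈ lowerFaces k σ, c τ} = ENNReal.ofReal (coinWeight p k σ.card) := by
  have h := pi_cylinder (fun s : Finset (Fin n) => bernoulliMeasure True False (p (s.card - 1)))
    (lowerFaces k σ) fun _ => {True}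
  simp only [bernoulli_true, prod_lowerFaces, Set.mem_singleton_iff, eq_iff_iff, iff_true] at h
  exact h

end Law

/-! ### Expected numbers of clusters -/

section Expectation

variable {d n k : ℕ} {f : EuclideanSpace ℝ (Fin d) → ℝ} {r : ℝ≥0}

lemma measurableSet_coin {n : ℕ} (A : Set (Finset (Fin n) → Prop)) : MeasurableSet A :=
  MeasurableSet.of_discrete

lemma measurableSet_clusterEvent (U σ : Finset (Fin n)) :
    MeasurableSet (clusterEvent d k r U σ) := by
  refine MeasurableSet.prod ?_ (measurableSet_coin _)
  have : {x : Fin n → EuclideanSpace ℝ (Fin d) | ∀ i ∈ U, ∀ j ∈ U, dist (x i) (x j) ≤ 3 * r} =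
      ⋂ i ∈ U, ⋂ j ∈ U, {x | dist (x i) (x j) ≤ 3 * r} := by
    ext x; simp
  rw [this]
  refine MeasurableSet.biInter U.countable_toSet fun i _ =>
    MeasurableSet.biInter U.countable_toSet fun j _ => ?_
  exact measurableSet_le (by fun_prop) measurable_const

/-- Pin one point of `U`. The other `U.card - 1` points fall independently into the ball of radius
`3 r` around it, and the coins are independent of the points. -/
lemma clusterEvent_le [IsProbabilityMeasure (pointLaw f)] {C : ℝ} (hC : 0 ≤ C)
    (hball : ∀ x, pointLaw f (Metric.closedBall x (3 * r)) ≤ ENNReal.ofReal (C * (r : ℝ) ^ d))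
    (p : ℕ → unitInterval) {U σ : Finset (Fin n)} (hU : U.Nonempty) :
    (softLaw f p n).real (clusterEvent d k r U σ) ≤
      (C * (r : ℝ) ^ d) ^ (U.card - 1) * coinWeight p k σ.card := by
  obtain ⟨v, hv⟩ := hU
  have h0 : 0 ≤ C * (r : ℝ) ^ d := by positivity
  refine ENNReal.toReal_le_of_le_ofReal (mul_nonneg (pow_nonneg h0 _) (coinWeight_nonneg _ _ _)) ?_
  rw [softLaw_eq, clusterEvent, Measure.prod_prod, coinLaw_lowerFaces,
    ENNReal.ofReal_mul (pow_nonneg h0 _)]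
  gcongr
  calc Measure.pi (fun _ : Fin n => pointLaw f) {x | ∀ i ∈ U, ∀ j ∈ U, dist (x i) (x j) ≤ 3 * r}
      ≤ Measure.pi (fun _ : Fin n => pointLaw f) {x | ∀ i ∈ U.erase v,
          (x v, x i) ∈ {q : EuclideanSpace ℝ (Fin d) × EuclideanSpace ℝ (Fin d) |
            dist q.2 q.1 ≤ 3 * r}} :=
        measure_mono fun x hx i hi => hx i (Finset.mem_of_mem_erase hi) v hv
    _ = ∫⁻ y, ∏ i ∈ U.erase v, pointLaw f (Metric.closedBall y (3 * r)) ∂pointLaw f :=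
        pi_pinned (pointLaw f) v (U.erase v) (Finset.notMem_erase v U) _ fun _ =>
          measurableSet_le (by fun_prop) measurable_const
    _ ≤ ∫⁻ _, ENNReal.ofReal (C * (r : ℝ) ^ d) ^ (U.card - 1) ∂pointLaw f := by
        refine lintegral_mono fun y => ?_
        rw [Finset.prod_const, Finset.card_erase_of_mem hv]
        gcongr
        exact hball y
    _ = _ := by
        rw [lintegral_const, measure_univ, mul_one, ENNReal.ofReal_pow h0]

/-- The expected number of pairs `σ ⊆ U` of prescribed cardinalities for which the cluster event
occurs. -/
lemma sum_clusterEvent_le [IsProbabilityMeasure (pointLaw f)] {C : ℝ} (hC : 0 ≤ C)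
    (hball : ∀ x, pointLaw f (Metric.closedBall x (3 * r)) ≤ ENNReal.ofReal (C * (r : ℝ) ^ d))
    (p : ℕ → unitInterval) (m s : ℕ) :
    ∑ U ∈ (Finset.univ : Finset (Fin n)).powersetCard (m + 1), ∑ σ ∈ U.powersetCard s,
      (softLaw f p n).real (clusterEvent d k r U σ) ≤
      2 ^ (m + 1) * C ^ m * ((n : ℝ) * (n * (r : ℝ) ^ d) ^ m * coinWeight p k s) := by
  have hW := coinWeight_nonneg p k s
  have h0 : 0 ≤ C * (r : ℝ) ^ d := by positivity
  calc _ ≤ ∑ U ∈ (Finset.univ : Finset (Fin n)).powersetCard (m + 1), ∑ σ ∈ U.powersetCard s,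
        (C * (r : ℝ) ^ d) ^ m * coinWeight p k s := by
        refine Finset.sum_le_sum fun U hU => Finset.sum_le_sum fun σ hσ => ?_
        have hUc := (Finset.mem_powersetCard.1 hU).2
        have := clusterEvent_le (k := k) hC hball p (U := U) (σ := σ)
          (Finset.card_pos.1 (by omega))
        rwa [hUc, (Finset.mem_powersetCard.1 hσ).2] at this
    _ ≤ ∑ U ∈ (Finset.univ : Finset (Fin n)).powersetCard (m + 1),
        2 ^ (m + 1) * ((C * (r : ℝ) ^ d) ^ m * coinWeight p k s) := by
        refine Finset.sum_le_sum fun U hU => ?_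
        rw [Finset.sum_const, nsmul_eq_mul, Finset.card_powersetCard,
          (Finset.mem_powersetCard.1 hU).2]
        gcongr
        exact_mod_cast Nat.choose_le_two_pow _ _
    _ ≤ (n : ℝ) ^ (m + 1) * (2 ^ (m + 1) * ((C * (r : ℝ) ^ d) ^ m * coinWeight p k s)) := by
        rw [Finset.sum_const, nsmul_eq_mul, Finset.card_powersetCard, Finset.card_univ,
          Fintype.card_fin]
        gcongr
        exact_mod_cast Nat.choose_le_pow _ _
    _ = _ := by ring

end Expectation

/-! ### Comparison of coin weights -/

section Weights

variable {k : ℕ} (p : ℕ → unitInterval)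

/-- Pascal's rule: a new vertex over `k + 1` old ones creates `(k + 1).choose i` new faces of
dimension `i`. This is the source of the denominator in the hypothesis of the theorem. -/
lemma coinWeight_mul_prod :
    coinWeight p k (k + 1) * ∏ i ∈ Finset.Icc 1 k, (p i : ℝ) ^ (k + 1).choose i =
      coinWeight p k (k + 2) := by
  rw [coinWeight, coinWeight, ← Finset.prod_mul_distrib]
  refine Finset.prod_congr rfl fun i _ => ?_
  rw [← pow_add, Nat.choose_succ_succ' (k + 1) i, add_comm]

lemma prod_le_one_of_coins (e : ℕ → ℕ) : ∏ i ∈ Finset.Icc 1 k, (p i : ℝ) ^ e i ≤ 1 :=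
  Finset.prod_le_one (fun i _ => pow_nonneg (p i).2.1 _) fun i _ => pow_le_one₀ (p i).2.1 (p i).2.2

end Weights

/-- Only subadditivity is used, so the events need not be measurable; measurability of the Betti
number never has to be checked. -/
lemma tendsto_measure_one_of_compl {Ω : ℕ → Type*} [∀ n, MeasurableSpace (Ω n)]
    (μ : ∀ n, Measure (Ω n)) (hμ : ∀ n, IsProbabilityMeasure (μ n)) (A : ∀ n, Set (Ω n))
    {b : ℕ → ℝ} (hb : Tendsto b atTop (𝓝 0)) (h : ∀ᶠ n in atTop, (μ n).real (A n)ᶜ ≤ b n) :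
    Tendsto (fun n => μ n (A n)) atTop (𝓝 1) := by
  have h1 : Tendsto (fun n => 1 - ENNReal.ofReal (b n)) atTop (𝓝 1) := by
    have := ENNReal.Tendsto.sub (tendsto_const_nhds (x := (1 : ENNReal)) (f := atTop))
      (ENNReal.tendsto_ofReal hb) (Or.inl ENNReal.one_ne_top)
    simpa using this
  refine tendsto_of_tendsto_of_tendsto_of_le_of_le' h1 tendsto_const_nhds ?_
    (Eventually.of_forall fun n => prob_le_one)
  filter_upwards [h] with n hn
  have h2 : μ n (A n)ᶜ ≤ ENNReal.ofReal (b n) := by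
    rw [← ENNReal.ofReal_toReal (measure_ne_top (μ n) (A n)ᶜ)]
    exact ENNReal.ofReal_le_ofReal hn
  refine tsub_le_iff_right.2 ?_
  calc 1 = μ n (A n ∪ (A n)ᶜ) := by rw [Set.union_compl_self, measure_univ]
    _ ≤ μ n (A n) + μ n (A n)ᶜ := measure_union_le _ _
    _ ≤ _ := by gcongr

instance isProbabilityMeasure_softLaw {d : ℕ} {f : EuclideanSpace ℝ (Fin d) → ℝ}
    [IsProbabilityMeasure (pointLaw f)] (p : ℕ → unitInterval) (n : ℕ) :
    IsProbabilityMeasure (softLaw f p n) := by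
  rw [softLaw_eq]; infer_instance

/-! ### Vanishing of homology by the first moment method -/

section Vanishing

variable (F : Type*) [Field F] {d k : ℕ} {f : EuclideanSpace ℝ (Fin d) → ℝ}

lemma betti_ne_zero_measure_le [IsProbabilityMeasure (pointLaw f)] (hk : 1 ≤ k) {C : ℝ}
    (hC : 0 ≤ C) {r : ℝ≥0}
    (hball : ∀ x, pointLaw f (Metric.closedBall x (3 * r)) ≤ ENNReal.ofReal (C * (r : ℝ) ^ d))
    (p : ℕ → unitInterval) (n : ℕ) :
    (softLaw f p n).real {ω | betti F (softCechComplex r ω.1 ω.2) k ≠ 0} ≤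
      2 ^ (k + 2) * C ^ (k + 1) * (n * (n * (r : ℝ) ^ d) ^ (k + 1) * coinWeight p k (k + 2)) +
      2 ^ (k + 3) * C ^ (k + 2) * (n * (n * (r : ℝ) ^ d) ^ (k + 2) * coinWeight p k (k + 1)) := by
  refine le_trans ?_ (add_le_add (sum_clusterEvent_le (n := n) (k := k) hC hball p (k + 1) (k + 2))
    (sum_clusterEvent_le (n := n) (k := k) hC hball p (k + 2) (k + 1)))
  let A (m s : ℕ) : Set ((Fin n → EuclideanSpace ℝ (Fin d)) × (Finset (Fin n) → Prop)) :=
    ⋃ U ∈ (Finset.univ : Finset (Fin n)).powersetCard m, ⋃ σ ∈ U.powersetCard s,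
      clusterEvent d k r U σ
  have hA : ∀ m s, (softLaw f p n).real (A m s) ≤
      ∑ U ∈ (Finset.univ : Finset (Fin n)).powersetCard m, ∑ σ ∈ U.powersetCard s,
        (softLaw f p n).real (clusterEvent d k r U σ) := fun m s =>
    (measureReal_biUnion_finset_le _ _).trans
      (Finset.sum_le_sum fun U _ => measureReal_biUnion_finset_le _ _)
  calc _ ≤ (softLaw f p n).real (A (k + 2) (k + 2) ∪ A (k + 3) (k + 1)) := by
        refine measureReal_mono fun ω hω => ?_
        rcases cluster_of_betti_ne_zero hk hω with ⟨U, hU, h⟩ | ⟨U, hU, σ, hσU, hσ, h⟩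
        · left
          exact Set.mem_biUnion (Finset.mem_powersetCard.2 ⟨Finset.subset_univ _, hU⟩)
            (Set.mem_biUnion (Finset.mem_powersetCard.2 ⟨Finset.Subset.refl _, hU⟩) h)
        · right
          exact Set.mem_biUnion (Finset.mem_powersetCard.2 ⟨Finset.subset_univ _, hU⟩)
            (Set.mem_biUnion (Finset.mem_powersetCard.2 ⟨hσU, hσ⟩) h)
    _ ≤ (softLaw f p n).real (A (k + 2) (k + 2)) + (softLaw f p n).real (A (k + 3) (k + 1)) :=
        measureReal_union_le _ _
    _ ≤ _ := add_le_add (hA _ _) (hA _ _)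

lemma expected_eq (p : ℕ → unitInterval) (n : ℕ) (r : ℝ≥0) :
    (∏ i ∈ Finset.Icc 1 k, (p i : ℝ) ^ (k + 2).choose (i + 1)) * (n : ℝ) ^ (k + 2) *
      (r : ℝ) ^ (d * (k + 1)) = n * (n * (r : ℝ) ^ d) ^ (k + 1) * coinWeight p k (k + 2) := by
  rw [coinWeight, pow_mul]; ring

theorem tendsto_betti_eq_zero [IsProbabilityMeasure (pointLaw f)] (hk : 1 ≤ k) {C : ℝ} (hC : 0 ≤ C)
    (hball : ∀ (x : EuclideanSpace ℝ (Fin d)) (r : ℝ≥0),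
      pointLaw f (Metric.closedBall x (3 * r)) ≤ ENNReal.ofReal (C * (r : ℝ) ^ d))
    (r : ℕ → ℝ≥0) (p : ℕ → ℕ → unitInterval)
    (hp : ∀ᶠ n in atTop, ∀ i ∈ Finset.Icc 1 k, 0 < p n i)
    (hsub : Tendsto (fun n : ℕ => (n : ℝ) * (r n : ℝ) ^ d /
      ∏ i ∈ Finset.Icc 1 k, (p n i : ℝ) ^ (k + 1).choose i) atTop (𝓝 0))
    (hQ : Tendsto (fun n : ℕ => (n : ℝ) * (n * (r n : ℝ) ^ d) ^ (k + 1) *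
      coinWeight (p n) k (k + 2)) atTop (𝓝 0)) :
    Tendsto (fun n : ℕ => softLaw f (p n) n
        {ω | betti F (softCechComplex (r n) ω.1 ω.2) k = 0}) atTop (𝓝 1) := by
  have hlim : Tendsto (fun n : ℕ => 2 ^ (k + 2) * C ^ (k + 1) * ((n : ℝ) *
      (n * (r n : ℝ) ^ d) ^ (k + 1) * coinWeight (p n) k (k + 2)) + 2 ^ (k + 3) * C ^ (k + 2) *
      (((n : ℝ) * (n * (r n : ℝ) ^ d) ^ (k + 1) * coinWeight (p n) k (k + 2)) * ((n : ℝ) *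
      (r n : ℝ) ^ d / ∏ i ∈ Finset.Icc 1 k, (p n i : ℝ) ^ (k + 1).choose i))) atTop (𝓝 0) := by
    simpa using (hQ.const_mul (2 ^ (k + 2) * C ^ (k + 1))).add
      ((hQ.mul hsub).const_mul (2 ^ (k + 3) * C ^ (k + 2)))
  refine tendsto_measure_one_of_compl _ (fun n => inferInstance) _ hlim ?_
  filter_upwards [hp] with n hn
  refine (betti_ne_zero_measure_le F hk hC (fun x => hball x (r n)) (p n) n).trans (le_of_eq ?_)
  have hpos : 0 < ∏ i ∈ Finset.Icc 1 k, (p n i : ℝ) ^ (k + 1).choose i :=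
    Finset.prod_pos fun i hi => pow_pos (hn i hi) _
  -- This turns the bound for `k + 3` points into Q times the ratio of `hsub`.
  rw [← coinWeight_mul_prod]
  field_simp
  ring

end Vanishing

/-! ### Shapes of missing simplices -/

section Geometry

/-- Vectors with the Gram matrix of a regular simplex with `m` vertices centred at the origin. -/
lemma exists_regular_simplex {m d : ℕ} (hm : m ≤ d) :
    ∃ u : Fin (m + 1) → EuclideanSpace ℝ (Fin d), ∀ i j,
      inner ℝ (u i) (u j) = (if i = j then 1 else 0) - 1 / ((m : ℝ) + 1) := by
  let e := EuclideanSpace.basisFun (Fin (m + 1)) ℝ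
  let s : EuclideanSpace ℝ (Fin (m + 1)) := ∑ i, e i
  have hes : ∀ i, inner ℝ (e i) s = 1 := fun i => by
    simp [s, inner_sum, e.inner_eq_ite]
  have hse : ∀ i, inner ℝ s (e i) = 1 := fun i => by rw [real_inner_comm, hes]
  have hss : inner ℝ s s = (m : ℝ) + 1 := by
    conv_lhs => rw [show s = ∑ i, e i from rfl, sum_inner]
    change ∑ i, inner ℝ (e i) s = _
    simp [hes]
  have hs0 : s ≠ 0 := by
    intro h
    rw [h, inner_zero_left] at hss
    linarith [m.cast_nonneg (α := ℝ)]
  let H := (ℝ ∙ s)ᗮ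
  have hfin : Module.finrank ℝ H = m := by
    have : Fact (Module.finrank ℝ (EuclideanSpace ℝ (Fin (m + 1))) = m + 1) := ⟨by simp⟩
    exact Submodule.finrank_orthogonal_span_singleton hs0
  -- The standard basis projected orthogonally to the all-ones vector; the hyperplane `H` has
  -- dimension `m` and embeds isometrically in dimension `d`.
  let v : Fin (m + 1) → EuclideanSpace ℝ (Fin (m + 1)) := fun i => e i - (1 / ((m : ℝ) + 1)) • s
  have hm0 : (m : ℝ) + 1 ≠ 0 := by positivity
  have hvH : ∀ i, v i ∈ H := fun i => by
    rw [Submodule.mem_orthogonal_singleton_iff_inner_right, inner_sub_right, inner_smul_right, hse,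
      hss]
    field_simp
    ring
  let g : Fin (Module.finrank ℝ H) → EuclideanSpace ℝ (Fin d) := fun i =>
    EuclideanSpace.basisFun (Fin d) ℝ (Fin.castLE (hfin.le.trans hm) i)
  have hg : Orthonormal ℝ g :=
    (EuclideanSpace.basisFun (Fin d) ℝ).orthonormal.comp _ (Fin.castLE_injective _)
  let B := stdOrthonormalBasis ℝ H
  let T := (B.toBasis.constr ℝ g).isometryOfOrthonormal (v := B.toBasis) (by simp [B.orthonormal])
    (by
      have : (B.toBasis.constr ℝ g) ∘ B.toBasis = g := by
        ext1 i; exact B.toBasis.constr_basis ℝ g i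
      rw [this]; exact hg)
  refine ⟨fun i => T ⟨v i, hvH i⟩, fun i j => ?_⟩
  rw [T.inner_map_map, Submodule.coe_inner]
  simp only [v, inner_sub_left, inner_sub_right, inner_smul_left, inner_smul_right, hes, hse, hss,
    e.inner_eq_ite]
  simp
  field_simp
  simp

/-- A simplex whose circumscribed ball is larger than those of its facets. -/
lemma exists_simplex_radius_gap {m d : ℕ} (hm0 : 1 ≤ m) (hm : m ≤ d) :
    ∃ (u : Fin (m + 1) → EuclideanSpace ℝ (Fin d)) (R₁ R₂ : ℝ), 0 ≤ R₁ ∧ R₁ < R₂ ∧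
      (∀ j, ∃ y, ∀ i ≠ j, dist y (u i) ≤ R₁) ∧ ∀ w, ∃ i, R₂ ≤ dist w (u i) := by
  obtain ⟨u, hu⟩ := exists_regular_simplex hm
  set δ : ℝ := 1 / ((m : ℝ) + 1) with hδ
  have hδ0 : 0 < δ := by positivity
  have hδ1 : δ ≤ 1 := by rw [hδ, div_le_one (by positivity)]; linarith [m.cast_nonneg (α := ℝ)]
  have hself : ∀ i, ‖u i‖ ^ 2 = 1 - δ := fun i => by rw [← real_inner_self_eq_norm_sq, hu]; simp
  have hδm : ((m : ℝ) + 1) * δ = 1 := by rw [hδ]; field_simp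
  have hsum : ∑ i, u i = 0 := by
    rw [← inner_self_eq_zero (𝕜 := ℝ), sum_inner]
    refine Finset.sum_eq_zero fun i _ => ?_
    rw [inner_sum]
    simp [hu, hδm]
  -- `√(1 - δ)` is the circumradius. Moving the centre from 0 to `-δ • u j`, towards the facet
  -- opposite `u j`, makes the squared distance to its vertices `1 - δ - δ² - δ³`.
  refine ⟨u, √(1 - δ - δ ^ 2), √(1 - δ), Real.sqrt_nonneg _, ?_, fun j => ⟨-δ • u j, fun i hi => ?_⟩,
    fun w => ?_⟩
  · have hm1 : (1 : ℝ) ≤ m := by exact_mod_cast hm0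
    exact (Real.sqrt_lt_sqrt_iff_of_pos (by nlinarith)).2 (by nlinarith)
  · refine Real.le_sqrt_of_sq_le ?_
    rw [dist_eq_norm, norm_sub_sq_real, norm_smul, mul_pow, inner_smul_left, hu, hself, hself,
      if_neg hi.symm]
    simp
    nlinarith [mul_pos hδ0 hδ0]
  -- Averaging: since the `u i` sum to zero, the mean of `‖w - u i‖²` is `‖w‖² + 1 - δ`.
  · by_contra! hcon
    have h1 : ∀ i, ‖w - u i‖ ^ 2 < 1 - δ := fun i => by
      have := hcon i
      rw [dist_eq_norm, Real.lt_sqrt (norm_nonneg _)] at this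
      exact this
    have h2 : ∑ i, ‖w - u i‖ ^ 2 < ∑ _i : Fin (m + 1), (1 - δ) :=
      Finset.sum_lt_sum_of_nonempty Finset.univ_nonempty fun i _ => h1 i
    have h3 : ∑ i, ‖w - u i‖ ^ 2 = ∑ _i : Fin (m + 1), (‖w‖ ^ 2 + (1 - δ)) := by
      simp only [norm_sub_sq_real, hself, Finset.sum_add_distrib, Finset.sum_sub_distrib,
        ← Finset.mul_sum, ← inner_sum, hsum]
      simp
    rw [h3] at h2
    refine h2.not_ge (Finset.sum_le_sum fun i _ => ?_)
    nlinarith [sq_nonneg ‖w‖]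

/-- Shapes such that every configuration close to a rescaled copy has a common point of the balls of
all but one of the points, and, unless the coin of the simplex fails (`True ∉ E`), no common point
of all the balls. -/
structure IsHollowShape {k d : ℕ} (b : Fin (k + 2) → EuclideanSpace ℝ (Fin d)) (η : ℝ)
    (E : Set Prop) : Prop where
  zero : b 0 = 0
  pos : 0 < η
  facet : ∀ (r : ℝ) (_ : 0 < r) (y : Fin (k + 2) → EuclideanSpace ℝ (Fin d)),
    (∀ i, dist (y i) (y 0 + r • b i) < r * η) → ∀ j, ∃ z, ∀ i ≠ j, dist z (y i) ≤ r / 2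
  full : True ∈ E → ∀ (r : ℝ) (_ : 0 < r) (y : Fin (k + 2) → EuclideanSpace ℝ (Fin d)),
    (∀ i, dist (y i) (y 0 + r • b i) < r * η) → ¬ ∃ z, ∀ i, dist z (y i) ≤ r / 2

/-- Here the points bunch together, the first one is a common point of all the balls, and only the
failing coin removes the simplex; the condition `full` is vacuous. -/
lemma isHollowShape_zero {k d : ℕ} :
    IsHollowShape (fun _ : Fin (k + 2) => (0 : EuclideanSpace ℝ (Fin d))) (1 / 2) {False} where
  zero := rfl
  pos := by norm_num
  facet r _ y h _ := ⟨y 0, fun i _ => by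
    have := h i
    rw [smul_zero, add_zero, dist_comm] at this
    linarith⟩
  full h := by simp at h

lemma exists_isHollowShape {k d : ℕ} (hkd : k < d) :
    ∃ (b : Fin (k + 2) → EuclideanSpace ℝ (Fin d)) (η : ℝ), IsHollowShape b η Set.univ := by
  obtain ⟨u, R₁, R₂, h1, h12, hfac, hfull⟩ := exists_simplex_radius_gap k.succ_pos (Nat.succ_le_of_lt hkd)
  have hpos : 0 < R₁ + R₂ := by linarith
  -- This scaling puts 1/2 exactly midway between `l * R₁` and `l * R₂`; the tolerance below is half
  -- of the common gap.
  set l : ℝ := 1 / (R₁ + R₂) with hl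
  have hl0 : 0 < l := by positivity
  have hl1 : l * R₁ + l * R₂ = 1 := by rw [hl]; field_simp
  have hl2 : l * R₁ < l * R₂ := by gcongr
  refine ⟨fun i => l • (u i - u 0), (1 / 2 - l * R₁) / 2, by simp, by linarith,
    fun r hr y hy j => ?_, fun _ r hr y hy => ?_⟩
  · obtain ⟨z, hz⟩ := hfac j
    refine ⟨y 0 + r • l • (z - u 0), fun i hi => ?_⟩
    have h2 : dist (y 0 + r • l • (z - u 0)) (y 0 + r • l • (u i - u 0)) ≤ r * (l * R₁) := by
      rw [dist_add_left, dist_smul₀, dist_smul₀, dist_sub_right, Real.norm_of_nonneg hr.le,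
        Real.norm_of_nonneg hl0.le]
      gcongr
      exact hz i hi
    have h3 := hy i
    rw [dist_comm] at h3
    have := dist_triangle (y 0 + r • l • (z - u 0)) (y 0 + r • l • (u i - u 0)) (y i)
    nlinarith
  · rintro ⟨z, hz⟩
    obtain ⟨i, hi⟩ := hfull (u 0 + (r * l)⁻¹ • (z - y 0))
    have h2 : dist z (y 0 + r • l • (u i - u 0)) =
        r * (l * dist (u 0 + (r * l)⁻¹ • (z - y 0)) (u i)) := by
      have : z - (y 0 + r • l • (u i - u 0)) = (r * l) • (u 0 + (r * l)⁻¹ • (z - y 0) - u i) := by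
        have hc : (r * l) • (r * l)⁻¹ • (z - y 0) = z - y 0 := smul_inv_smul₀ (by positivity) _
        rw [smul_sub (r * l), smul_add (r * l), hc]
        module
      rw [dist_eq_norm, dist_eq_norm, this, norm_smul, Real.norm_of_nonneg (by positivity), mul_assoc]
    have h3 := dist_triangle z (y i) (y 0 + r • l • (u i - u 0))
    have h4 : r * (l * R₂) ≤ r * (l * dist (u 0 + (r * l)⁻¹ • (z - y 0)) (u i)) := by gcongr
    have := hy i
    have := hz i
    nlinarith

end Geometry

/-! ### Missing simplices and their neighbours -/

section EmptySimplex

variable {F : Type*} [Field F] {d n k : ℕ} {r : ℝ≥0}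
  {b : Fin (k + 2) → EuclideanSpace ℝ (Fin d)} {η : ℝ} {E : Set Prop}

/-- The configurations of points in which the points of `σ` are close to a copy of `b` scaled by
`r`. -/
def shapeSet {d n k : ℕ} (b : Fin (k + 2) → EuclideanSpace ℝ (Fin d)) (η : ℝ) (r : ℝ≥0)
    (σ : Finset (Fin n)) : Set (Fin n → EuclideanSpace ℝ (Fin d)) :=
  {x | ∃ e : Fin (k + 2) ≃ σ, ∀ i, dist (x (e i)) (x (e 0) + (r : ℝ) • b i) < r * η}

/-- The outcomes of the coins for which the proper faces of `σ` are kept and the coin of `σ` lies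
in `E`. -/
def coinSet {n : ℕ} (k : ℕ) (E : Set Prop) (σ : Finset (Fin n)) : Set (Finset (Fin n) → Prop) :=
  {c | (∀ τ ∈ lowerFaces k σ, c τ) ∧ c σ ∈ E}

/-- The event that `σ` spans an empty simplex of a given shape. -/
def emptySimplexEvent {d n k : ℕ} (b : Fin (k + 2) → EuclideanSpace ℝ (Fin d)) (η : ℝ)
    (E : Set Prop) (r : ℝ≥0) (σ : Finset (Fin n)) :
    Set ((Fin n → EuclideanSpace ℝ (Fin d)) × (Finset (Fin n) → Prop)) :=
  shapeSet b η r σ ×ˢ coinSet k E σ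

section

variable {σ : Finset (Fin n)}
  {ω : (Fin n → EuclideanSpace ℝ (Fin d)) × (Finset (Fin n) → Prop)}

lemma card_of_mem_emptySimplexEvent (hω : ω ∈ emptySimplexEvent b η E r σ) : σ.card = k + 2 := by
  obtain ⟨⟨e, -⟩, -⟩ := hω
  simpa using (Fintype.card_congr e).symm

lemma pos_of_mem_emptySimplexEvent (hb : IsHollowShape b η E)
    (hω : ω ∈ emptySimplexEvent b η E r σ) : (0 : ℝ) < r := by
  obtain ⟨⟨e, he⟩, -⟩ := hω
  exact pos_of_mul_pos_left (dist_nonneg.trans_lt (he 0)) hb.pos.le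

lemma facet_mem_of_mem_emptySimplexEvent (hb : IsHollowShape b η E)
    (hω : ω ∈ emptySimplexEvent b η E r σ) {v : Fin n} (hv : v ∈ σ) :
    σ.erase v ∈ softCechComplex r ω.1 ω.2 := by
  have hr := pos_of_mem_emptySimplexEvent hb hω
  have hcard := card_of_mem_emptySimplexEvent hω
  obtain ⟨⟨e, he⟩, hc, -⟩ := hω
  have hcard' := Finset.card_erase_of_mem hv
  refine mem_softCechComplex.2 ⟨Finset.card_pos.1 (by omega), ?_, fun τ hτ h2 => hc τ ?_⟩
  · obtain ⟨z, hz⟩ := hb.facet r hr (fun i => ω.1 (e i)) he (e.symm ⟨v, hv⟩)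
    refine ⟨z, fun i hi => ?_⟩
    have := hz (e.symm ⟨i, Finset.mem_of_mem_erase hi⟩) fun h =>
      Finset.ne_of_mem_erase hi (by simpa using h)
    simpa using this
  · have := Finset.card_le_card hτ
    simp only [lowerFaces, Finset.mem_filter, Finset.mem_powerset, Finset.mem_Icc]
    exact ⟨hτ.trans (Finset.erase_subset _ _), h2, by omega⟩

/-- As `σ` has at least three vertices, any two of them lie in a common facet, which is a face of
the complex. -/
lemma dist_le_of_mem_emptySimplexEvent (hk : 1 ≤ k) (hb : IsHollowShape b η E)
    (hω : ω ∈ emptySimplexEvent b η E r σ) {i j : Fin n} (hi : i ∈ σ) (hj : j ∈ σ) :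
    dist (ω.1 i) (ω.1 j) ≤ r := by
  have hcard := card_of_mem_emptySimplexEvent hω
  obtain ⟨v, hv, hvn⟩ : ∃ v ∈ σ, v ∉ ({i, j} : Finset (Fin n)) :=
    Finset.exists_mem_notMem_of_card_lt_card
      (lt_of_le_of_lt (Finset.card_le_two (a := i) (b := j)) (by omega))
  simp only [Finset.mem_insert, Finset.mem_singleton, not_or] at hvn
  exact dist_le_of_mem_softCechComplex (facet_mem_of_mem_emptySimplexEvent hb hω hv)
    (Finset.mem_erase.2 ⟨fun h => hvn.1 h.symm, hi⟩)
    (Finset.mem_erase.2 ⟨fun h => hvn.2 h.symm, hj⟩)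

/-- A face made of a facet and an outside vertex `w` puts all of `σ` and `w` within `r` of one
vertex `u` of that facet, hence creates a forbidden cluster. -/
lemma betti_ne_zero_of_mem_emptySimplexEvent (hk : 1 ≤ k) (hb : IsHollowShape b η E)
    (hω : ω ∈ emptySimplexEvent b η E r σ)
    (hiso : ∀ w ∉ σ, ω ∉ clusterEvent d k r (insert w σ) σ) :
    betti F (softCechComplex r ω.1 ω.2) k ≠ 0 := by
  have hr := pos_of_mem_emptySimplexEvent hb hω
  have hcard := card_of_mem_emptySimplexEvent hω
  refine betti_ne_zero_of_empty_simplex hcard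
    (fun v hv => facet_mem_of_mem_emptySimplexEvent hb hω hv) ?_ ?_
  · intro hσ
    obtain ⟨-, ⟨z, hz⟩, hcoin⟩ := mem_softCechComplex.1 hσ
    obtain ⟨⟨e, he⟩, -, hE⟩ := hω
    have hT : True ∈ E := eq_true (hcoin σ subset_rfl (by omega)) ▸ hE
    exact hb.full hT r hr _ he ⟨z, fun i => hz _ (e i).2⟩
  · intro v hv w hw hmem
    refine hiso w hw ⟨?_, hω.2.1⟩
    obtain ⟨u, hu⟩ : (σ.erase v).Nonempty := by
      rw [← Finset.card_pos, Finset.card_erase_of_mem hv]; omega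
    have hwu : dist (ω.1 w) (ω.1 u) ≤ r := dist_le_of_mem_softCechComplex hmem (by simp)
      (Finset.mem_insert_of_mem hu)
    have hσ := fun i hi j hj => dist_le_of_mem_emptySimplexEvent hk hb hω (i := i) (j := j) hi hj
    have hu' := Finset.mem_of_mem_erase hu
    have hws : ∀ i ∈ insert w σ, dist (ω.1 i) (ω.1 u) ≤ r := fun i hi => by
      rcases Finset.mem_insert.1 hi with rfl | hi
      exacts [hwu, hσ i hi u hu']
    intro i hi j hj
    linarith [dist_triangle_right (ω.1 i) (ω.1 j) (ω.1 u), hws i hi, hws j hj]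

/-- All points are within `r` of a shared vertex. Dropping the coins of the second simplex costs
nothing in the order of the variance bound. -/
lemma inter_subset_clusterEvent (hk : 1 ≤ k) (hb : IsHollowShape b η E) {σ' : Finset (Fin n)}
    (h : ¬ Disjoint σ σ') : emptySimplexEvent b η E r σ ∩ emptySimplexEvent b η E r σ' ⊆
      clusterEvent d k r (σ ∪ σ') σ := by
  rintro ω ⟨hω, hω'⟩
  have hr := pos_of_mem_emptySimplexEvent hb hω
  obtain ⟨u, hu, hu'⟩ := Finset.not_disjoint_iff.1 h
  refine ⟨?_, hω.2.1⟩
  have hws : ∀ i ∈ σ ∪ σ', dist (ω.1 i) (ω.1 u) ≤ r := fun i hi => by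
    rcases Finset.mem_union.1 hi with hi | hi
    exacts [dist_le_of_mem_emptySimplexEvent hk hb hω hi hu,
      dist_le_of_mem_emptySimplexEvent hk hb hω' hi hu']
  intro i hi j hj
  linarith [dist_triangle_right (ω.1 i) (ω.1 j) (ω.1 u), hws i hi, hws j hj]

end

end EmptySimplex

/-! ### First and second moment inequalities -/

section Moments

open ProbabilityTheory

variable {Ω κ : Type*} [MeasurableSpace Ω] {μ : Measure Ω} [IsProbabilityMeasure μ]
  {s : Finset κ} {A : κ → Set Ω}

lemma memLp_indicator (B : Set Ω) (hB : MeasurableSet B) :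
    MemLp (B.indicator fun _ => (1 : ℝ)) 2 μ :=
  memLp_indicator_const 2 hB 1 (Or.inr (measure_ne_top _ _))

lemma integral_sum_indicator (hA : ∀ i ∈ s, MeasurableSet (A i)) :
    ∫ ω, (∑ i ∈ s, (A i).indicator (fun _ => (1 : ℝ)) ω) ∂μ = ∑ i ∈ s, μ.real (A i) := by
  rw [integral_finsetSum _ fun i hi => (memLp_indicator (μ := μ) _ (hA i hi)).integrable (by simp)]
  refine Finset.sum_congr rfl fun i hi => ?_
  rw [integral_indicator_const _ (hA i hi), smul_eq_mul, mul_one]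

lemma markov_sum_indicator (hA : ∀ i ∈ s, MeasurableSet (A i)) {t : ℝ} (ht : 0 < t) :
    μ.real {ω | t ≤ ∑ i ∈ s, (A i).indicator (fun _ => (1 : ℝ)) ω} ≤
      (∑ i ∈ s, μ.real (A i)) / t := by
  rw [le_div_iff₀' ht, ← integral_sum_indicator hA]
  refine mul_meas_ge_le_integral_of_nonneg (ae_of_all _ fun ω => Finset.sum_nonneg fun i _ =>
    Set.indicator_nonneg (fun _ _ => zero_le_one) _) ?_ t
  exact integrable_finsetSum _ fun i hi =>
    (memLp_indicator (μ := μ) _ (hA i hi)).integrable (by simp)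

/-- The second moment method for counting events most pairs of which are independent. -/
lemma chebyshev_sum_indicator (hA : ∀ i ∈ s, MeasurableSet (A i)) (R : κ → κ → Prop)
    [∀ i, DecidablePred (R i)]
    (hR : ∀ i ∈ s, ∀ j ∈ s, ¬ R i j → μ.real (A i ∩ A j) = μ.real (A i) * μ.real (A j))
    (hpos : 0 < ∑ i ∈ s, μ.real (A i)) :
    μ.real {ω | ∑ i ∈ s, (A i).indicator (fun _ => (1 : ℝ)) ω ≤ (∑ i ∈ s, μ.real (A i)) / 2} ≤
      4 * (∑ i ∈ s, ∑ j ∈ s.filter (R i), μ.real (A i ∩ A j)) / (∑ i ∈ s, μ.real (A i)) ^ 2 := by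
  set S := ∑ i ∈ s, μ.real (A i) with hS
  let X : κ → Ω → ℝ := fun i => (A i).indicator fun _ => (1 : ℝ)
  have hX : ∀ i ∈ s, MemLp (X i) 2 μ := fun i hi => memLp_indicator _ (hA i hi)
  have hsumX : (∑ i ∈ s, X i) = fun ω => ∑ i ∈ s, (A i).indicator (fun _ => (1 : ℝ)) ω := by
    ext ω; simp [X]
  have hcov : ∀ i ∈ s, ∀ j ∈ s, cov[X i, X j; μ] =
      μ.real (A i ∩ A j) - μ.real (A i) * μ.real (A j) := by
    intro i hi j hj
    rw [covariance_eq_sub (hX i hi) (hX j hj)]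
    have : X i * X j = (A i ∩ A j).indicator fun _ => (1 : ℝ) := by
      ext ω
      by_cases h1 : ω ∈ A i <;> by_cases h2 : ω ∈ A j <;> simp [X, h1, h2]
    rw [this, integral_indicator_const _ ((hA i hi).inter (hA j hj)),
      integral_indicator_const _ (hA i hi), integral_indicator_const _ (hA j hj)]
    simp
  have hvar : Var[∑ i ∈ s, X i; μ] ≤ ∑ i ∈ s, ∑ j ∈ s.filter (R i), μ.real (A i ∩ A j) := by
    rw [variance_sum' hX]
    refine Finset.sum_le_sum fun i hi => ?_
    rw [Finset.sum_filter]
    refine Finset.sum_le_sum fun j hj => ?_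
    rw [hcov i hi j hj]
    split_ifs with h
    · have : 0 ≤ μ.real (A i) * μ.real (A j) := by positivity
      linarith
    · rw [hR i hi j hj h, sub_self]
  have hmean : ∫ ω, (∑ i ∈ s, X i) ω ∂μ = S := by
    rw [hsumX]; exact integral_sum_indicator hA
  have hcheb := meas_ge_le_variance_div_sq (μ := μ) (memLp_finsetSum' s hX) (half_pos hpos)
  have h1 : μ.real {ω | ∑ i ∈ s, (A i).indicator (fun _ => (1 : ℝ)) ω ≤ S / 2} ≤
      Var[∑ i ∈ s, X i; μ] / (S / 2) ^ 2 := by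
    refine ENNReal.toReal_le_of_le_ofReal (div_nonneg (variance_nonneg _ _) (by positivity))
      (le_trans (measure_mono fun ω hω => ?_) hcheb)
    have hω' : (∑ i ∈ s, X i) ω ≤ S / 2 := by rw [hsumX]; exact hω
    change S / 2 ≤ |(∑ i ∈ s, X i) ω - ∫ ω, (∑ i ∈ s, X i) ω ∂μ|
    rw [hmean, abs_sub_comm]
    exact le_trans (by linarith) (le_abs_self _)
  calc _ ≤ Var[∑ i ∈ s, X i; μ] / (S / 2) ^ 2 := h1
    _ ≤ (∑ i ∈ s, ∑ j ∈ s.filter (R i), μ.real (A i ∩ A j)) / (S / 2) ^ 2 := by gcongr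
    _ = _ := by ring

end Moments

/-! ### Counting overlapping pairs and nearby vertices -/

section Counting

variable {d n k : ℕ} {f : EuclideanSpace ℝ (Fin d) → ℝ} {r : ℝ≥0}

/-- A set is determined by its parts inside and outside `σ`. -/
lemma card_filter_sdiff_le {n : ℕ} (σ : Finset (Fin n)) (m j : ℕ) :
    (((Finset.univ : Finset (Fin n)).powersetCard m).filter fun σ' => (σ' \ σ).card = j).card ≤
      2 ^ σ.card * n ^ j := by
  calc _ ≤ (σ.powerset ×ˢ (Finset.univ : Finset (Fin n)).powersetCard j).card := by
        refine Finset.card_le_card_of_injOn (fun σ' => (σ' ∩ σ, σ' \ σ)) ?_ ?_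
        · intro σ' hσ'
          have := (Finset.mem_filter.1 (Finset.mem_coe.1 hσ')).2
          simp [this]
        · intro a _ b _ hab
          simp only [Prod.mk.injEq] at hab
          rw [← Finset.sdiff_union_inter a σ, hab.1, hab.2, Finset.sdiff_union_inter]
    _ ≤ _ := by
        rw [Finset.card_product, Finset.card_powerset, Finset.card_powersetCard, Finset.card_univ,
          Fintype.card_fin]
        exact Nat.mul_le_mul_left _ (Nat.choose_le_pow _ _)

/-- The expected number of pairs of simplices that share a vertex. -/
lemma sum_clusterEvent_union_le [IsProbabilityMeasure (pointLaw f)] {C : ℝ} (hC : 0 ≤ C)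
    (hball : ∀ x, pointLaw f (Metric.closedBall x (3 * r)) ≤ ENNReal.ofReal (C * (r : ℝ) ^ d))
    (p : ℕ → unitInterval) (hr : n * (r : ℝ) ^ d ≤ 1) :
    ∑ σ ∈ (Finset.univ : Finset (Fin n)).powersetCard (k + 2),
      ∑ σ' ∈ (Finset.univ : Finset (Fin n)).powersetCard (k + 2),
        (softLaw f p n).real (clusterEvent d k r (σ ∪ σ') σ) ≤
      (2 ^ (k + 2) * ∑ j ∈ Finset.range (k + 3), C ^ (k + 1 + j)) *
        (n * (n * (r : ℝ) ^ d) ^ (k + 1) * coinWeight p k (k + 2)) := by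
  have hW := coinWeight_nonneg p k (k + 2)
  have hinner : ∀ σ ∈ (Finset.univ : Finset (Fin n)).powersetCard (k + 2),
      ∑ σ' ∈ (Finset.univ : Finset (Fin n)).powersetCard (k + 2),
        (softLaw f p n).real (clusterEvent d k r (σ ∪ σ') σ) ≤
      ∑ j ∈ Finset.range (k + 3), 2 ^ (k + 2) * (n : ℝ) ^ j *
        ((C * (r : ℝ) ^ d) ^ (k + 1 + j) * coinWeight p k (k + 2)) := by
    intro σ hσ
    have hσc := (Finset.mem_powersetCard.1 hσ).2
    -- Sort by the number `j` of new vertices; each costs a factor `n r^d ≤ 1`. Disjoint pairs (`j =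
    -- k + 2`) are harmless, because the event still requires the union to be close.
    rw [← Finset.sum_fiberwise_of_maps_to (t := Finset.range (k + 3))
      (g := fun σ' : Finset (Fin n) => (σ' \ σ).card) (fun σ' hσ' => by
        have h1 := Finset.card_le_card (Finset.sdiff_subset (s := σ') (t := σ))
        rw [(Finset.mem_powersetCard.1 hσ').2] at h1
        exact Finset.mem_range.2 (by omega))]
    refine Finset.sum_le_sum fun j _ => ?_
    refine (Finset.sum_le_card_nsmul _ _ ((C * (r : ℝ) ^ d) ^ (k + 1 + j) *
      coinWeight p k (k + 2)) fun σ' hσ' => ?_).trans ?_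
    · have hj := (Finset.mem_filter.1 hσ').2
      have hU : (σ ∪ σ').card = k + 2 + j := by
        rw [← Finset.union_sdiff_self_eq_union, Finset.card_union_of_disjoint
          Finset.disjoint_sdiff, hσc, hj]
      have := clusterEvent_le (k := k) hC hball p (U := σ ∪ σ') (σ := σ)
        (Finset.card_pos.1 (by omega))
      rwa [hU, hσc, show k + 2 + j - 1 = k + 1 + j by omega] at this
    · rw [nsmul_eq_mul]
      have h2 := card_filter_sdiff_le σ (k + 2) j
      rw [hσc] at h2
      gcongr
      exact_mod_cast h2
  refine (Finset.sum_le_card_nsmul _ _ _ hinner).trans ?_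
  rw [nsmul_eq_mul, Finset.card_powersetCard, Finset.card_univ, Fintype.card_fin]
  calc _ ≤ (n : ℝ) ^ (k + 2) * ∑ j ∈ Finset.range (k + 3), 2 ^ (k + 2) * (n : ℝ) ^ j *
        ((C * (r : ℝ) ^ d) ^ (k + 1 + j) * coinWeight p k (k + 2)) := by
        gcongr
        exact_mod_cast Nat.choose_le_pow _ _
    _ = ∑ j ∈ Finset.range (k + 3), (n * (r : ℝ) ^ d) ^ j * (2 ^ (k + 2) * C ^ (k + 1 + j) *
        (n * (n * (r : ℝ) ^ d) ^ (k + 1) * coinWeight p k (k + 2))) := by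
        rw [Finset.mul_sum]
        refine Finset.sum_congr rfl fun j _ => ?_
        ring
    _ ≤ ∑ j ∈ Finset.range (k + 3), 1 * (2 ^ (k + 2) * C ^ (k + 1 + j) *
        (n * (n * (r : ℝ) ^ d) ^ (k + 1) * coinWeight p k (k + 2))) := by
        gcongr
        exact pow_le_one₀ (by positivity) hr
    _ = _ := by
        rw [Finset.mul_sum, Finset.sum_mul]
        simp only [one_mul]

/-- The expected number of pairs of a simplex and a further vertex close to it. -/
lemma sum_clusterEvent_insert_le [IsProbabilityMeasure (pointLaw f)] {C : ℝ} (hC : 0 ≤ C)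
    (hball : ∀ x, pointLaw f (Metric.closedBall x (3 * r)) ≤ ENNReal.ofReal (C * (r : ℝ) ^ d))
    (p : ℕ → unitInterval) :
    ∑ q ∈ ((Finset.univ : Finset (Fin n)).powersetCard (k + 2)).sigma fun σ => σᶜ,
        (softLaw f p n).real (clusterEvent d k r (insert q.2 q.1) q.1) ≤
      C ^ (k + 2) * (n * (r : ℝ) ^ d) *
        (n * (n * (r : ℝ) ^ d) ^ (k + 1) * coinWeight p k (k + 2)) := by
  have hW := coinWeight_nonneg p k (k + 2)
  rw [Finset.sum_sigma]
  calc _ ≤ ∑ σ ∈ (Finset.univ : Finset (Fin n)).powersetCard (k + 2),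
        n * ((C * (r : ℝ) ^ d) ^ (k + 2) * coinWeight p k (k + 2)) := by
        refine Finset.sum_le_sum fun σ hσ => ?_
        have hσc := (Finset.mem_powersetCard.1 hσ).2
        refine (Finset.sum_le_card_nsmul _ _ ((C * (r : ℝ) ^ d) ^ (k + 2) *
          coinWeight p k (k + 2)) fun w hw => ?_).trans ?_
        · have := clusterEvent_le (k := k) hC hball p (U := insert w σ) (σ := σ)
            (Finset.insert_nonempty _ _)
          rwa [Finset.card_insert_of_notMem (Finset.mem_compl.1 hw), hσc] at this
        · rw [nsmul_eq_mul]
          gcongr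
          exact_mod_cast (Finset.card_le_univ _).trans_eq (Fintype.card_fin n)
    _ ≤ (n : ℝ) ^ (k + 2) * (n * ((C * (r : ℝ) ^ d) ^ (k + 2) * coinWeight p k (k + 2))) := by
        rw [Finset.sum_const, nsmul_eq_mul, Finset.card_powersetCard, Finset.card_univ,
          Fintype.card_fin]
        gcongr
        exact_mod_cast Nat.choose_le_pow _ _
    _ = _ := by ring

end Counting

/-! ### Probabilities and independence of missing simplices -/

section EmptySimplexLaw

variable {d n k : ℕ} {f : EuclideanSpace ℝ (Fin d) → ℝ} {r : ℝ≥0}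
  {b : Fin (k + 2) → EuclideanSpace ℝ (Fin d)} {η : ℝ} {E : Set Prop}

lemma measurableSet_shapeSet (σ : Finset (Fin n)) : MeasurableSet (shapeSet b η r σ) := by
  have : shapeSet b η r σ = ⋃ e : Fin (k + 2) ≃ σ, ⋂ i,
      {x | dist (x (e i)) (x (e 0) + (r : ℝ) • b i) < r * η} := by
    ext x; simp [shapeSet]
  rw [this]
  refine MeasurableSet.iUnion fun e => MeasurableSet.iInter fun i => ?_
  exact measurableSet_lt (by fun_prop) measurable_const

lemma measurableSet_emptySimplexEvent (σ : Finset (Fin n)) :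
    MeasurableSet (emptySimplexEvent b η E r σ) :=
  (measurableSet_shapeSet σ).prod (measurableSet_coin _)

lemma notMem_lowerFaces {σ : Finset (Fin n)} (hσ : σ.card = k + 2) : σ ∉ lowerFaces k σ := by
  simp [lowerFaces, hσ]

lemma coinLaw_coinSet (p : ℕ → unitInterval) {σ : Finset (Fin n)} (hσ : σ.card = k + 2) :
    coinLaw p n (coinSet k E σ) = ENNReal.ofReal (coinWeight p k (k + 2)) *
      ProbabilityTheory.bernoulliMeasure True False (p (k + 1)) E := by
  have h := pi_cylinder
    (fun s : Finset (Fin n) => ProbabilityTheory.bernoulliMeasure True False (p (s.card - 1)))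
    (insert σ (lowerFaces k σ)) fun τ => if τ = σ then E else {True}
  have hne : ∀ τ ∈ lowerFaces k σ, τ ≠ σ := fun τ hτ h => notMem_lowerFaces hσ (h ▸ hτ)
  rw [Finset.prod_insert (notMem_lowerFaces hσ), Finset.prod_congr (s₂ := lowerFaces k σ) rfl
    fun τ hτ => by rw [if_neg (hne τ hτ), bernoulli_true], prod_lowerFaces, if_pos rfl, hσ,
    mul_comm] at h
  rw [← show k + 2 - 1 = k + 1 by omega, ← h, coinLaw]
  congr 1
  ext c
  simp only [coinSet, Finset.forall_mem_insert, if_true, Set.mem_ofPred_eq]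
  rw [and_comm]
  refine and_congr_right fun _ => forall₂_congr fun τ hτ => ?_
  simp [hne τ hτ]

lemma softLaw_emptySimplexEvent_inter [IsProbabilityMeasure (pointLaw f)] (p : ℕ → unitInterval)
    {σ σ' : Finset (Fin n)} (hσ : σ.card = k + 2) (hσ' : σ'.card = k + 2) (h : Disjoint σ σ') :
    softLaw f p n (emptySimplexEvent b η E r σ ∩ emptySimplexEvent b η E r σ') =
      softLaw f p n (emptySimplexEvent b η E r σ) *
        softLaw f p n (emptySimplexEvent b η E r σ') := by
  have hshape : ∀ (ρ : Finset (Fin n)) (x y : Fin n → EuclideanSpace ℝ (Fin d)),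
      (∀ i ∈ ρ, x i = y i) → x ∈ shapeSet b η r ρ → y ∈ shapeSet b η r ρ := by
    rintro ρ x y hxy ⟨e, he⟩
    refine ⟨e, fun i => ?_⟩
    rw [← hxy _ (e i).2, ← hxy _ (e 0).2]
    exact he i
  have hcoin : ∀ (ρ : Finset (Fin n)) (x y : Finset (Fin n) → Prop),
      (∀ τ ∈ insert ρ (lowerFaces k ρ), x τ = y τ) → x ∈ coinSet k E ρ → y ∈ coinSet k E ρ := by
    rintro ρ x y hxy ⟨h1, h2⟩
    refine ⟨fun τ hτ => hxy τ (Finset.mem_insert_of_mem hτ) ▸ h1 τ hτ, ?_⟩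
    rw [← hxy ρ (Finset.mem_insert_self _ _)]
    exact h2
  -- Only the empty set is a subset of two disjoint simplices, and every coin considered sits on at
  -- least two vertices.
  have hdisj : Disjoint (insert σ (lowerFaces k σ)) (insert σ' (lowerFaces k σ')) := by
    have key : ∀ ρ : Finset (Fin n), ρ.card = k + 2 → ∀ τ ∈ insert ρ (lowerFaces k ρ),
        τ ⊆ ρ ∧ 2 ≤ τ.card := by
      intro ρ hρ τ hτ
      rcases Finset.mem_insert.1 hτ with rfl | hτ
      · exact ⟨subset_rfl, by omega⟩
      · simp only [lowerFaces, Finset.mem_filter, Finset.mem_powerset, Finset.mem_Icc] at hτ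
        exact ⟨hτ.1, hτ.2.1⟩
    refine Finset.disjoint_left.2 fun τ h1 h2 => ?_
    have h3 := key σ hσ τ h1
    have := Finset.disjoint_of_subset_left h3.1
      (Finset.disjoint_of_subset_right (key σ' hσ' τ h2).1 h)
    rw [Finset.disjoint_self_iff_empty] at this
    simp [this] at h3
  rw [softLaw_eq, emptySimplexEvent, emptySimplexEvent, Set.prod_inter_prod, Measure.prod_prod,
    Measure.prod_prod, Measure.prod_prod, coinLaw,
    pi_inter_of_disjoint _ h (measurableSet_shapeSet σ) (measurableSet_shapeSet σ') (hshape σ)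
      (hshape σ'),
    pi_inter_of_disjoint _ hdisj (measurableSet_coin _) (measurableSet_coin _) (hcoin σ)
      (hcoin σ')]
  ring

end EmptySimplexLaw

/-! ### Lower bound for the probability of a shape -/

section LowerBound

variable {d n k : ℕ} {f : EuclideanSpace ℝ (Fin d) → ℝ}
  {b : Fin (k + 2) → EuclideanSpace ℝ (Fin d)} {η : ℝ}

/-- The probability that `k + 1` further points are placed relative to a first one as in `b`,
rescaled by `r`. -/
noncomputable def shapeMass (f : EuclideanSpace ℝ (Fin d) → ℝ)
    (b : Fin (k + 2) → EuclideanSpace ℝ (Fin d)) (η : ℝ) (r : ℝ≥0) : ENNReal :=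
  ∫⁻ y, ∏ j ∈ Finset.univ.erase 0, pointLaw f (Metric.ball (y + (r : ℝ) • b j) (r * η)) ∂pointLaw f

/-- One labelling of `σ` by the vertices of the shape already gives the bound. -/
lemma shapeMass_le [IsProbabilityMeasure (pointLaw f)] (hb : b 0 = 0) (hη : 0 < η) {r : ℝ≥0}
    (hr : 0 < r) {σ : Finset (Fin n)} (hσ : σ.card = k + 2) :
    shapeMass f b η r ≤ Measure.pi (fun _ : Fin n => pointLaw f) (shapeSet b η r σ) := by
  classical
  have hr' : (0 : ℝ) < r := hr
  let e : Fin (k + 2) ≃ σ := (σ.equivFinOfCardEq hσ).symm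
  let b' : Fin n → EuclideanSpace ℝ (Fin d) := fun i => if h : i ∈ σ then b (e.symm ⟨i, h⟩) else 0
  have hb' : ∀ j, b' (e j) = b j := fun j => by simp [b']
  have hT : σ.erase (e 0) =
      (Finset.univ.erase 0).map (e.toEmbedding.trans (Function.Embedding.subtype _)) := by
    ext i
    simp only [Finset.mem_erase, Finset.mem_map, Finset.mem_univ, and_true]
    constructor
    · rintro ⟨h1, h2⟩
      refine ⟨e.symm ⟨i, h2⟩, fun h => h1 ?_, by simp⟩
      rw [← h]
      simp
    · rintro ⟨j, hj, rfl⟩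
      refine ⟨fun h => hj (e.injective (Subtype.ext h)), (e j).2⟩
  have h := pi_pinned (pointLaw f) (e 0 : Fin n) (σ.erase (e 0)) (Finset.notMem_erase _ _)
    (fun i => {q | dist q.2 (q.1 + (r : ℝ) • b' i) < r * η})
    fun i => measurableSet_lt (by fun_prop) measurable_const
  have hmass : shapeMass f b η r = ∫⁻ y, ∏ i ∈ σ.erase (e 0), pointLaw f {z | (y, z) ∈
      {q : EuclideanSpace ℝ (Fin d) × EuclideanSpace ℝ (Fin d) |
        dist q.2 (q.1 + (r : ℝ) • b' i) < r * η}} ∂pointLaw f := by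
    refine lintegral_congr fun y => ?_
    rw [hT, Finset.prod_map]
    refine Finset.prod_congr rfl fun j _ => ?_
    simp only [Function.Embedding.trans_apply, Equiv.coe_toEmbedding,
      Function.Embedding.subtype_apply, hb']
    rfl
  rw [hmass, ← h]
  refine measure_mono fun x hx => ⟨e, fun i => ?_⟩
  by_cases hi : i = 0
  · subst hi
    rw [hb, smul_zero, add_zero, dist_self]
    positivity
  · have := hx (e i) (Finset.mem_erase.2 ⟨fun h => hi (e.injective (Subtype.ext h)), (e i).2⟩)
    rw [← hb' i]
    exact this

/-- The mass divided by the volumes of the balls has, by Fatou, a lower limit at least `∫ f ^ (k +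
2)` up to a constant, and this is positive. No continuity of `f` is needed. -/
lemma exists_shapeMass_ge [IsProbabilityMeasure (pointLaw f)] (hf : Measurable f) (hη : 0 < η)
    {r : ℕ → ℝ≥0} (hr : Tendsto (fun n => (r n : ℝ)) atTop (𝓝 0)) (hr0 : ∀ᶠ n in atTop, 0 < r n) :
    ∃ c : ℝ, 0 < c ∧ ∀ᶠ n in atTop,
      ENNReal.ofReal (c * (r n : ℝ) ^ (d * (k + 1))) ≤ shapeMass f b η (r n) := by
  classical
  let E := EuclideanSpace ℝ (Fin d)
  let w (n : ℕ) (j : Fin (k + 2)) (y : E) : E := y + (r n : ℝ) • b j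
  let δ (n : ℕ) : ℝ := r n * (η / 2)
  have hδ : Tendsto δ atTop (𝓝[>] 0) := by
    refine tendsto_nhdsWithin_iff.2 ⟨?_, ?_⟩
    · simpa [δ] using hr.mul_const (η / 2)
    · filter_upwards [hr0] with n hn
      have : (0 : ℝ) < r n := hn
      exact Set.mem_Ioi.2 (by positivity)
  -- The balls are not centred at `y`, but their centres stay within `K` radii of it, as the
  -- differentiation theorem permits.
  obtain ⟨K, hK⟩ : ∃ K : ℝ, ∀ j, ‖b j‖ ≤ K * (η / 2) := by
    refine ⟨(∑ j, ‖b j‖) / (η / 2), fun j => ?_⟩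
    rw [div_mul_cancel₀ _ (by positivity)]
    exact Finset.single_le_sum (f := fun j => ‖b j‖) (fun _ _ => norm_nonneg _) (Finset.mem_univ j)
  let V (n : ℕ) : ENNReal := volume (Metric.closedBall (0 : E) (δ n))
  let g (n : ℕ) (y : E) : ENNReal :=
    ∏ j ∈ Finset.univ.erase 0, pointLaw f (Metric.closedBall (w n j y) (δ n)) / V n
  have hg : ∀ n, Measurable (g n) := fun n => by
    refine Finset.measurable_prod _ fun j _ => Measurable.div_const ?_ _
    have hs : MeasurableSet {q : E × E | dist q.2 (w n j q.1) ≤ δ n} :=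
      measurableSet_le (by simp only [w]; fun_prop) measurable_const
    exact measurable_measure_prodMk_left hs
  have hfin : ∫⁻ y, ENNReal.ofReal (f y) = 1 := by
    have : pointLaw f Set.univ = 1 := measure_univ
    rwa [pointLaw, withDensity_apply _ MeasurableSet.univ, Measure.restrict_univ] at this
  have hlim : ∀ᵐ y ∂pointLaw f, Tendsto (fun n => g n y) atTop
      (𝓝 (∏ _j ∈ (Finset.univ : Finset (Fin (k + 2))).erase 0, ENNReal.ofReal (f y))) := by
    refine (withDensity_absolutelyContinuous _ _).ae_le ?_
    filter_upwards [(IsUnifLocDoublingMeasure.vitaliFamily (volume : Measure E) K).ae_tendsto_lintegral_div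
      (f := fun y => ENNReal.ofReal (f y)) hf.ennreal_ofReal.aemeasurable
      (by rw [hfin]; exact ENNReal.one_ne_top)] with y hy
    refine ENNReal.tendsto_finsetProd_of_ne_top _ (fun j _ => ?_) fun j _ => ENNReal.ofReal_ne_top
    have := hy.comp (IsUnifLocDoublingMeasure.tendsto_closedBall_filterAt (μ := (volume : Measure E)) (K := K)
      (fun n => w n j y) δ hδ (Eventually.of_forall fun n => by
        rw [Metric.mem_closedBall, dist_eq_norm]
        simp only [w, δ, sub_add_cancel_left, norm_neg, norm_smul, Real.norm_eq_abs,
          NNReal.abs_eq]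
        have := mul_le_mul_of_nonneg_left (hK j) (r n).coe_nonneg
        calc _ ≤ _ := this
          _ = _ := by ring))
    refine this.congr fun n => ?_
    simp only [Function.comp, V]
    rw [pointLaw, withDensity_apply _ Metric.isClosed_closedBall.measurableSet,
      Measure.addHaar_closedBall_center]
  have hpos : 0 < ∫⁻ y, liminf (fun n => g n y) atTop ∂pointLaw f := by
    rw [lintegral_congr_ae (hlim.mono fun y hy => hy.liminf_eq), pos_iff_ne_zero]
    intro h0
    rw [pointLaw, lintegral_withDensity_eq_lintegral_mul _ hf.ennreal_ofReal
      (Finset.measurable_prod _ fun _ _ => hf.ennreal_ofReal), lintegral_eq_zero_iff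
      (hf.ennreal_ofReal.mul (Finset.measurable_prod _ fun _ _ => hf.ennreal_ofReal))] at h0
    have h1 : ∫⁻ y, ENNReal.ofReal (f y) = ∫⁻ _ : E, 0 := by
      refine lintegral_congr_ae (h0.mono fun y hy => ?_)
      by_contra hne
      simp only [Pi.mul_apply, Finset.prod_const, Pi.zero_apply, mul_eq_zero, pow_eq_zero_iff'] at hy
      rcases hy with hy | hy
      exacts [hne hy, hne hy.1]
    rw [hfin, lintegral_zero] at h1
    exact one_ne_zero h1
  obtain ⟨c, hc0, hc⟩ := ENNReal.lt_iff_exists_nnreal_btwn.1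
    (hpos.trans_le (lintegral_liminf_le (u := atTop) hg))
  have hev := eventually_lt_of_lt_liminf hc
  have hc0' : 0 < c := by exact_mod_cast hc0
  let v : ℝ := (volume (Metric.ball (0 : E) 1)).toReal
  have hv : 0 < v := ENNReal.toReal_pos (Metric.measure_ball_pos _ _ one_pos).ne'
    measure_ball_lt_top.ne
  refine ⟨c * ((η / 2) ^ d * v) ^ (k + 1), by positivity, ?_⟩
  filter_upwards [hev, hr0] with n hn hrn
  have hrn' : (0 : ℝ) < r n := hrn
  have hδn : 0 < δ n := by positivity
  have hV : V n = ENNReal.ofReal (δ n ^ d * v) := by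
    simp only [V]
    rw [Measure.addHaar_closedBall _ _ hδn.le, finrank_euclideanSpace, Fintype.card_fin,
      ENNReal.ofReal_mul (by positivity), ENNReal.ofReal_toReal measure_ball_lt_top.ne]
  have hV0 : V n ≠ 0 := by rw [hV]; exact (ENNReal.ofReal_pos.2 (by positivity)).ne'
  have hVt : V n ≠ ⊤ := by rw [hV]; exact ENNReal.ofReal_ne_top
  calc ENNReal.ofReal (c * ((η / 2) ^ d * v) ^ (k + 1) * (r n : ℝ) ^ (d * (k + 1)))
      = c * V n ^ (k + 1) := by
        rw [hV, ← ENNReal.ofReal_pow (by positivity), ← ENNReal.ofReal_coe_nnreal,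
          ← ENNReal.ofReal_mul c.coe_nonneg]
        congr 1
        simp only [δ]
        rw [pow_mul]
        ring
    _ ≤ (∫⁻ y, g n y ∂pointLaw f) * V n ^ (k + 1) := by gcongr
    _ = ∫⁻ y, g n y * V n ^ (k + 1) ∂pointLaw f :=
        (lintegral_mul_const' _ _ (ENNReal.pow_ne_top hVt)).symm
    _ ≤ shapeMass f b η (r n) := by
        refine lintegral_mono fun y => ?_
        have hcard : ((Finset.univ : Finset (Fin (k + 2))).erase 0).card = k + 1 := by simp
        simp only [g]
        rw [← hcard, ← Finset.prod_const, ← Finset.prod_mul_distrib]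
        refine Finset.prod_le_prod' fun j _ => ?_
        rw [ENNReal.div_mul_cancel hV0 hVt]
        refine measure_mono (Metric.closedBall_subset_ball ?_)
        simp only [δ]
        nlinarith

end LowerBound

/-! ### Nonvanishing of homology by the second moment method -/

section NonVanishing

variable (F : Type*) [Field F] {d k : ℕ} {f : EuclideanSpace ℝ (Fin d) → ℝ}
  {b : Fin (k + 2) → EuclideanSpace ℝ (Fin d)} {η : ℝ} {E : Set Prop}

/-- If the homology vanishes, each missing simplex has a nearby outside vertex, so pairs are at
least as numerous as missing simplices. Either the latter fall to half their mean `S`, or the pairs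
reach `S / 2`. -/
lemma betti_eq_zero_measure_le [IsProbabilityMeasure (pointLaw f)] (hk : 1 ≤ k)
    (hb : IsHollowShape b η E) {C : ℝ} (hC : 0 ≤ C) {n : ℕ} {r : ℝ≥0}
    (hball : ∀ x, pointLaw f (Metric.closedBall x (3 * r)) ≤ ENNReal.ofReal (C * (r : ℝ) ^ d))
    (p : ℕ → unitInterval) (hr : n * (r : ℝ) ^ d ≤ 1)
    (hS : 0 < ∑ σ ∈ (Finset.univ : Finset (Fin n)).powersetCard (k + 2),
      (softLaw f p n).real (emptySimplexEvent b η E r σ)) :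
    (softLaw f p n).real {ω | betti F (softCechComplex r ω.1 ω.2) k = 0} ≤
      4 * ((2 ^ (k + 2) * ∑ j ∈ Finset.range (k + 3), C ^ (k + 1 + j)) *
        (n * (n * (r : ℝ) ^ d) ^ (k + 1) * coinWeight p k (k + 2))) /
        (∑ σ ∈ (Finset.univ : Finset (Fin n)).powersetCard (k + 2),
          (softLaw f p n).real (emptySimplexEvent b η E r σ)) ^ 2 +
      C ^ (k + 2) * (n * (r : ℝ) ^ d) *
        (n * (n * (r : ℝ) ^ d) ^ (k + 1) * coinWeight p k (k + 2)) /
        ((∑ σ ∈ (Finset.univ : Finset (Fin n)).powersetCard (k + 2),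
          (softLaw f p n).real (emptySimplexEvent b η E r σ)) / 2) := by
  classical
  set s := (Finset.univ : Finset (Fin n)).powersetCard (k + 2) with hs
  set S := ∑ σ ∈ s, (softLaw f p n).real (emptySimplexEvent b η E r σ) with hSdef
  have hcheb := chebyshev_sum_indicator (μ := softLaw f p n) (s := s)
    (A := emptySimplexEvent b η E r) (fun σ _ => measurableSet_emptySimplexEvent σ)
    (fun σ σ' => ¬ Disjoint σ σ') (fun σ hσ σ' hσ' h => by
      rw [measureReal_def, softLaw_emptySimplexEvent_inter p (Finset.mem_powersetCard.1 hσ).2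
        (Finset.mem_powersetCard.1 hσ').2 (not_not.1 h), ENNReal.toReal_mul]
      rfl) hS
  have hmarkov := markov_sum_indicator (μ := softLaw f p n) (s := s.sigma fun σ => σᶜ)
    (A := fun q => clusterEvent d k r (insert q.2 q.1) q.1)
    (fun q _ => measurableSet_clusterEvent _ _) (half_pos hS)
  have hD : ∑ σ ∈ s, ∑ σ' ∈ s.filter (fun σ' => ¬ Disjoint σ σ'), (softLaw f p n).real
      (emptySimplexEvent b η E r σ ∩ emptySimplexEvent b η E r σ') ≤
      (2 ^ (k + 2) * ∑ j ∈ Finset.range (k + 3), C ^ (k + 1 + j)) *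
        (n * (n * (r : ℝ) ^ d) ^ (k + 1) * coinWeight p k (k + 2)) := by
    refine le_trans (Finset.sum_le_sum fun σ _ => ?_) (sum_clusterEvent_union_le hC hball p hr)
    calc _ ≤ ∑ σ' ∈ s.filter (fun σ' => ¬ Disjoint σ σ'),
          (softLaw f p n).real (clusterEvent d k r (σ ∪ σ') σ) :=
          Finset.sum_le_sum fun σ' hσ' => measureReal_mono
            (inter_subset_clusterEvent hk hb (Finset.mem_filter.1 hσ').2)
      _ ≤ _ := Finset.sum_le_sum_of_subset_of_nonneg (Finset.filter_subset _ _)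
          fun _ _ _ => measureReal_nonneg
  calc _ ≤ (softLaw f p n).real
        ({ω | ∑ σ ∈ s, (emptySimplexEvent b η E r σ).indicator (fun _ => (1 : ℝ)) ω ≤ S / 2} ∪
          {ω | S / 2 ≤ ∑ q ∈ s.sigma fun σ => σᶜ,
            (clusterEvent d k r (insert q.2 q.1) q.1).indicator (fun _ => (1 : ℝ)) ω}) := by
        refine measureReal_mono fun ω hω => ?_
        by_contra hcon
        simp only [Set.mem_union, Set.mem_ofPred_eq, not_or, not_le] at hcon
        refine hcon.2.not_ge (hcon.1.le.trans ?_)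
        rw [Finset.sum_sigma]
        refine Finset.sum_le_sum fun σ _ => ?_
        have h0 : ∀ w ∈ σᶜ, 0 ≤ (clusterEvent d k r (insert w σ) σ).indicator
            (fun _ => (1 : ℝ)) ω := fun w _ => Set.indicator_nonneg (fun _ _ => zero_le_one) _
        by_cases hσ : ω ∈ emptySimplexEvent b η E r σ
        · rw [Set.indicator_of_mem hσ]
          obtain ⟨w, hw, hwc⟩ : ∃ w ∉ σ, ω ∈ clusterEvent d k r (insert w σ) σ := by
            by_contra! hno
            exact betti_ne_zero_of_mem_emptySimplexEvent hk hb hσ hno hω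
          refine le_trans (le_of_eq ?_) (Finset.single_le_sum h0 (Finset.mem_compl.2 hw))
          rw [Set.indicator_of_mem hwc]
        · rw [Set.indicator_of_notMem hσ]
          exact Finset.sum_nonneg h0
    _ ≤ _ := measureReal_union_le _ _
    _ ≤ _ := add_le_add hcheb hmarkov
    _ ≤ _ := by
        gcongr
        exact sum_clusterEvent_insert_le hC hball p

lemma pow_le_mul_choose {m n : ℕ} (h : 2 * m ≤ n) :
    (n : ℝ) ^ m ≤ 2 ^ m * m.factorial * n.choose m := by
  have h1 := Nat.pow_le_choose (α := ℝ) m n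
  rw [div_le_iff₀ (by positivity)] at h1
  have h2 : (n : ℝ) ≤ 2 * ((n + 1 - m : ℕ) : ℝ) := by
    have : n ≤ 2 * (n + 1 - m) := by omega
    exact_mod_cast this
  calc (n : ℝ) ^ m ≤ (2 * ((n + 1 - m : ℕ) : ℝ)) ^ m := by gcongr
    _ = 2 ^ m * ((n + 1 - m : ℕ) : ℝ) ^ m := by rw [mul_pow]
    _ ≤ 2 ^ m * (n.choose m * m.factorial) := by gcongr
    _ = _ := by ring

/-- The expected number of empty simplices of a given shape is at least a multiple of the expected
number of boundaries of simplices. -/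
lemma sum_emptySimplexEvent_ge [IsProbabilityMeasure (pointLaw f)] (hb : IsHollowShape b η E)
    {n : ℕ} (hn : 2 * (k + 2) ≤ n) {r : ℝ≥0} (hr : 0 < r) (p : ℕ → unitInterval) {c q : ℝ}
    (hc : 0 ≤ c) (hq : 0 ≤ q)
    (hmass : ENNReal.ofReal (c * (r : ℝ) ^ (d * (k + 1))) ≤ shapeMass f b η r)
    (hE : ENNReal.ofReal q ≤ ProbabilityTheory.bernoulliMeasure True False (p (k + 1)) E) :
    c * q / (2 ^ (k + 2) * (k + 2).factorial) *
      (n * (n * (r : ℝ) ^ d) ^ (k + 1) * coinWeight p k (k + 2)) ≤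
      ∑ σ ∈ (Finset.univ : Finset (Fin n)).powersetCard (k + 2),
        (softLaw f p n).real (emptySimplexEvent b η E r σ) := by
  have hW := coinWeight_nonneg p k (k + 2)
  have hσ : ∀ σ ∈ (Finset.univ : Finset (Fin n)).powersetCard (k + 2),
      c * (r : ℝ) ^ (d * (k + 1)) * (coinWeight p k (k + 2) * q) ≤
        (softLaw f p n).real (emptySimplexEvent b η E r σ) := by
    intro σ hσ
    have hσc := (Finset.mem_powersetCard.1 hσ).2
    rw [measureReal_def, ← ENNReal.ofReal_le_iff_le_toReal (measure_ne_top _ _), softLaw_eq,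
      emptySimplexEvent, Measure.prod_prod, coinLaw_coinSet p hσc,
      ENNReal.ofReal_mul (by positivity), ENNReal.ofReal_mul hW]
    gcongr
    exact hmass.trans (shapeMass_le hb.zero hb.pos hr hσc)
  refine le_trans ?_ (Finset.card_nsmul_le_sum _ _ _ hσ)
  rw [nsmul_eq_mul, Finset.card_powersetCard, Finset.card_univ, Fintype.card_fin, div_mul_eq_mul_div,
    div_le_iff₀ (by positivity)]
  calc _ = (n : ℝ) ^ (k + 2) * (c * (r : ℝ) ^ (d * (k + 1)) * (coinWeight p k (k + 2) * q)) := by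
        rw [pow_mul]; ring
    _ ≤ 2 ^ (k + 2) * (k + 2).factorial * n.choose (k + 2) *
        (c * (r : ℝ) ^ (d * (k + 1)) * (coinWeight p k (k + 2) * q)) := by
        gcongr
        exact pow_le_mul_choose hn
    _ = _ := by ring

/-- Since the mean is at least `c'` times Q, the failure probability is O(1/Q) + O(n r^d). -/
theorem tendsto_betti_ne_zero [IsProbabilityMeasure (pointLaw f)] (hf : Measurable f) (hk : 1 ≤ k)
    (hb : IsHollowShape b η E) {C : ℝ} (hC : 0 ≤ C)
    (hball : ∀ (x : EuclideanSpace ℝ (Fin d)) (r : ℝ≥0),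
      pointLaw f (Metric.closedBall x (3 * r)) ≤ ENNReal.ofReal (C * (r : ℝ) ^ d))
    (r : ℕ → ℝ≥0) (p : ℕ → ℕ → unitInterval) (hr : Tendsto (fun n => (r n : ℝ)) atTop (𝓝 0))
    (hr0 : ∀ᶠ n in atTop, 0 < r n)
    (hsparse : Tendsto (fun n : ℕ => (n : ℝ) * (r n : ℝ) ^ d) atTop (𝓝 0))
    (hQ : Tendsto (fun n : ℕ => (n : ℝ) * (n * (r n : ℝ) ^ d) ^ (k + 1) *
      coinWeight (p n) k (k + 2)) atTop atTop) {q : ℝ} (hq : 0 < q)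
    (hE : ∀ᶠ n in atTop, ENNReal.ofReal q ≤
      ProbabilityTheory.bernoulliMeasure True False (p n (k + 1)) E) :
    Tendsto (fun n : ℕ => softLaw f (p n) n
        {ω | betti F (softCechComplex (r n) ω.1 ω.2) k ≠ 0}) atTop (𝓝 1) := by
  obtain ⟨c, hc, hmass⟩ := exists_shapeMass_ge (b := b) (k := k) hf hb.pos hr hr0
  set K : ℝ := 2 ^ (k + 2) * ∑ j ∈ Finset.range (k + 3), C ^ (k + 1 + j) with hK
  have hK0 : 0 ≤ K := by positivity
  set c' : ℝ := c * q / (2 ^ (k + 2) * (k + 2).factorial) with hc'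
  have hc'0 : 0 < c' := by positivity
  have hlim : Tendsto (fun n : ℕ => 4 * K / c' ^ 2 * ((n : ℝ) * (n * (r n : ℝ) ^ d) ^ (k + 1) *
      coinWeight (p n) k (k + 2))⁻¹ + 2 * C ^ (k + 2) / c' * (n * (r n : ℝ) ^ d)) atTop (𝓝 0) := by
    simpa using (hQ.inv_tendsto_atTop.const_mul (4 * K / c' ^ 2)).add
      (hsparse.const_mul (2 * C ^ (k + 2) / c'))
  refine tendsto_measure_one_of_compl _ (fun n => inferInstance) _ hlim ?_
  filter_upwards [hmass, hE, hr0, hQ.eventually_gt_atTop 0, eventually_ge_atTop (2 * (k + 2)),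
    hsparse.eventually_le_const zero_lt_one] with n h1 h2 h3 h4 h5 h6
  have hge := sum_emptySimplexEvent_ge (f := f) hb h5 h3 (p n) hc.le hq.le h1 h2
  rw [← hc'] at hge
  have hcompl : {ω : (Fin n → EuclideanSpace ℝ (Fin d)) × (Finset (Fin n) → Prop) |
      betti F (softCechComplex (r n) ω.1 ω.2) k ≠ 0}ᶜ =
      {ω | betti F (softCechComplex (r n) ω.1 ω.2) k = 0} := by
    ext ω; simp
  rw [hcompl]
  refine (betti_eq_zero_measure_le F hk hb hC (fun x => hball x (r n)) (p n) h6
    (lt_of_lt_of_le (by positivity) hge)).trans ?_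
  rw [← hK]
  set Q := (n : ℝ) * (n * (r n : ℝ) ^ d) ^ (k + 1) * coinWeight (p n) k (k + 2) with hQdef
  calc _ ≤ 4 * (K * Q) / (c' * Q) ^ 2 +
        C ^ (k + 2) * (n * (r n : ℝ) ^ d) * Q / (c' * Q / 2) := by gcongr
    _ = _ := by field_simp

end NonVanishing
end SoftCech

theorem mainTheorem2 (F : Type*) [Field F] (d k : ℕ) (hk : 1 ≤ k)
    (f : EuclideanSpace ℝ (Fin d) → ℝ) (hf_meas : Measurable f) (hf_nonneg : ∀ x, 0 ≤ f x)
    (hf_int : ∫ x, f x = 1) (hf_bdd : ∃ M : ℝ, ∀ᵐ x, f x ≤ M)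
    (r : ℕ → ℝ≥0) (p : ℕ → ℕ → unitInterval)
    (hp : ∀ᶠ n in atTop, ∀ i ∈ Finset.Icc 1 k, 0 < p n i)
    (hsub : Tendsto (fun n : ℕ => (n : ℝ) * (r n : ℝ) ^ d /
      ∏ i ∈ Finset.Icc 1 k, (p n i : ℝ) ^ (k + 1).choose i) atTop (𝓝 0)) :
    (Tendsto (fun n : ℕ => (∏ i ∈ Finset.Icc 1 k, (p n i : ℝ) ^ (k + 2).choose (i + 1)) *
        (n : ℝ) ^ (k + 2) * (r n : ℝ) ^ (d * (k + 1))) atTop (𝓝 0) →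
      Tendsto (fun n : ℕ => SoftCech.softLaw f (p n) n
        {ω | SoftCech.betti F (SoftCech.softCechComplex (r n) ω.1 ω.2) k = 0}) atTop (𝓝 1)) ∧
    ((k < d ∨ ∃ q : ℝ, q < 1 ∧ ∀ᶠ n in atTop, (p n (k + 1) : ℝ) ≤ q) →
      Tendsto (fun n : ℕ => (∏ i ∈ Finset.Icc 1 k, (p n i : ℝ) ^ (k + 2).choose (i + 1)) *
        (n : ℝ) ^ (k + 2) * (r n : ℝ) ^ (d * (k + 1))) atTop atTop →
      Tendsto (fun n : ℕ => SoftCech.softLaw f (p n) n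
        {ω | SoftCech.betti F (SoftCech.softCechComplex (r n) ω.1 ω.2) k ≠ 0}) atTop (𝓝 1)) := by
  have := SoftCech.isProbabilityMeasure_pointLaw hf_nonneg hf_int
  obtain ⟨C, hC, hball⟩ := SoftCech.pointLaw_closedBall_le hf_bdd
  simp only [SoftCech.expected_eq]
  refine ⟨fun hQ => SoftCech.tendsto_betti_eq_zero F hk hC hball r p hp hsub hQ, fun hcase hQ => ?_⟩
  have hsparse : Tendsto (fun n : ℕ => (n : ℝ) * (r n : ℝ) ^ d) atTop (𝓝 0) := by
    refine squeeze_zero' (Eventually.of_forall fun n => by positivity) ?_ hsub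
    filter_upwards [hp] with n hn
    exact le_div_self (by positivity) (Finset.prod_pos fun i hi => pow_pos (hn i hi) _)
      (SoftCech.prod_le_one_of_coins (p n) _)
  -- In dimension zero `n r^d = n` does not tend to zero.
  have hd : d ≠ 0 := by
    rintro rfl
    simp only [pow_zero, mul_one] at hsparse
    exact not_tendsto_nhds_of_tendsto_atTop tendsto_natCast_atTop_atTop 0 hsparse
  have hrd : Tendsto (fun n => (r n : ℝ) ^ d) atTop (𝓝 0) := by
    refine squeeze_zero' (Eventually.of_forall fun n => by positivity) ?_ hsparse
    filter_upwards [eventually_ge_atTop 1] with n hn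
    exact le_mul_of_one_le_left (by positivity) (by exact_mod_cast hn)
  -- Needed for Lebesgue differentiation at scale `r n`.
  have hr : Tendsto (fun n => (r n : ℝ)) atTop (𝓝 0) := by
    have h := hrd.rpow_const (p := (d : ℝ)⁻¹) (Or.inr (by positivity))
    rw [Real.zero_rpow (by positivity)] at h
    exact h.congr fun n => Real.pow_rpow_inv_natCast (r n).2 hd
  have hr0 : ∀ᶠ n in atTop, 0 < r n := by
    filter_upwards [hQ.eventually_gt_atTop 0] with n hn
    rw [pos_iff_ne_zero]
    intro h0
    simp [h0, hd] at hn
  -- For `k < d` the shape alone excludes the simplex, so its coin is unrestricted; otherwise the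
  -- coin must fail, with probability at least `1 - q`.
  rcases hcase with hkd | ⟨q, hq, hpq⟩
  · obtain ⟨b, η, hb⟩ := SoftCech.exists_isHollowShape hkd
    refine SoftCech.tendsto_betti_ne_zero F hf_meas hk hb hC hball r p hr hr0 hsparse hQ one_pos
      (Eventually.of_forall fun n => ?_)
    rw [measure_univ, ENNReal.ofReal_one]
  · refine SoftCech.tendsto_betti_ne_zero F hf_meas hk SoftCech.isHollowShape_zero hC hball r p hr
      hr0 hsparse hQ (sub_pos.2 hq) ?_
    filter_upwards [hpq] with n hn
    rw [SoftCech.bernoulli_false]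
    exact ENNReal.ofReal_le_ofReal (by linarith)
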